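/- Let $a<t<b$, let $m,q\ge 1$ be integers, and let $g\in C^\infty(a,b)$ be real-valued and integrable on $(a,b)$; put $f(x)=g(x)/(x-t)^m$. Let $\psi\in C[\alpha,\beta]\cap C^\infty(\alpha,\beta)$ with $\psi(\alpha)=a$, $\psi(\beta)=b$ and $\psi'>0$ on $(\alpha,\beta)$, and let $\tau\in(\alpha,\beta)$ be the point with $\psi(\tau)=t$. Put $$F(\xi)=f(\psi(\xi))\,\psi'(\xi)=\frac{G(\xi)}{(\xi-\tau)^m},\qquad G(\xi)=\frac{g(\psi(\xi))\,\psi'(\xi)}{\psi[\xi,\tau]^m},$$ where $\psi[\xi,\tau]=\frac{\psi(\xi)-\psi(\tau)}{\xi-\tau}$ for $\xi\ne\tau$ and $\psi[\tau,\tau]=\psi'(\tau)$. Say that a function $\Phi$ on $(\alpha,\beta)$ is *periodized to order $k$* if $\Phi^{(i)}(\xi)\to0$ as $\xi\to\alpha+$ and as $\xi\to\beta-$ for $i=0,\dots,k-1$, and $\Phi^{(k)}$ is absolutely integrable near $\alpha$ and near $\beta$. Assume that $F$ is periodized to order $q$. Let $\mathcal T=\beta-\alpha$, let $\mathcal F$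 be the $\mathcal T$-periodic extension of $F$ from $(\alpha,\beta)$, with $\mathcal F(\beta+k\mathcal T)=0$ for all integers $k$, and let $h=\mathcal T/n$, $n=1,2,\dots$. Let $$I[F]=\int_\alpha^\beta F(\xi)\,d\xi\quad\text{(Hadamard finite part)}$$ be what remains in the limit $\epsilon\to0+$ of $\int_\alpha^{\tau-\epsilon}F\,d\xi+\int_{\tau+\epsilon}^{\beta}F\,d\xi$ after the divergent terms of its expansion (a linear combination of negative integer powers of $\epsilon$ and $\log\epsilon$) are discarded. Then $I[F]$ exists, and as $n\to\infty$ (that is, $h\to0$), with $\zeta$ the Riemann zeta function: 1. If $m=2r$, $r=1,2,\dots$, then $$h\sum_{j=1}^{n-1}\mathcal F(\tau+jh)=I[F]+2\sum_{i=0}^{r}\frac{G^{(2i)}(\tau)}{(2i)!}\,\zeta(2r-2i)\,h^{-2r+2i+1}+O(h^q).$$ 2. If $m=2r+1$, $r=0,1,\dots$, then $$h\sum_{j=1}^{n-1}\mathcal F(\tau+jh)=I[F]+2\sum_{i=0}^{r}\frac{G^{(2i+1)}(\tau)}{(2i+1)!}\,\zeta(2r-2i)\,h^{-2r+2i+1}+O(h^q).$$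 Moreover, the admissible orders $q$ depend only on $\psi$ and on the behaviour of $g$ at $a$ and $b$, and not on $m$ (or $t$): if $k\ge0$ is an integer with $\psi\in C^k[\alpha,\beta]$, if $g_1\in C^\infty(a,b)$ coincides with $g$ near $a$ and near $b$, and if $t_1\in(a,b)$ and $m_1\ge1$, then $\dfrac{g_1(\psi(\xi))}{(\psi(\xi)-t_1)^{m_1}}\,\psi'(\xi)$ is periodized to order $k$ if and only if $F$ is. -/

import Mathlib

open Set Filter Topology MeasureTheory Asymptotics
open scoped ContDiff Nat

namespace PVTSI

noncomputable section

/-- The singular integrand `f(x) = g(x) / (x - t)^m`. -/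
def singularIntegrand (g : ℝ → ℝ) (t : ℝ) (m : ℕ) (x : ℝ) : ℝ :=
  g x / (x - t) ^ m

/-- The transformed integrand `F(ξ) = f(ψ(ξ)) ψ'(ξ)`. -/
def transformed (g ψ : ℝ → ℝ) (t : ℝ) (m : ℕ) (ξ : ℝ) : ℝ :=
  singularIntegrand g t m (ψ ξ) * deriv ψ ξ

/-- `G(ξ) = g(ψ(ξ)) ψ'(ξ) / ψ[ξ,τ]^m`, so that `F(ξ) = G(ξ) / (ξ - τ)^m` for `ξ ≠ τ`. Here
`dslope ψ τ ξ` is the divided difference `ψ[ξ,τ]`, equal to `(ψ(ξ) - ψ(τ)) / (ξ - τ)` for `ξ ≠ τ`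
and to `ψ'(τ)` for `ξ = τ`. -/
def regularPart (g ψ : ℝ → ℝ) (τ : ℝ) (m : ℕ) (ξ : ℝ) : ℝ :=
  g (ψ ξ) * deriv ψ ξ / dslope ψ τ ξ ^ m

/-- The `(β - α)`-periodic extension of a function given on `(α, β)` that tends to `0` at both
endpoints: the value at the points `α + k (β - α)` is the limit `0`. -/
def periodicExtension (F : ℝ → ℝ) (α β ξ : ℝ) : ℝ :=
  if ξ - (⌊(ξ - α) / (β - α)⌋ : ℝ) * (β - α) = α then 0
  else F (ξ - (⌊(ξ - α) / (β - α)⌋ : ℝ) * (β - α))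

/-- `F` is periodized to order `q` on `(α, β)`: the derivatives `F^(i)`, `i < q`, vanish at `α` and
at `β` (as one-sided limits), and `F^(q)` is absolutely integrable near `α` and near `β`, that is,
the `q`-th derivative of the periodic extension of `F` is absolutely integrable through `β`. -/
def PeriodizedToOrder (F : ℝ → ℝ) (α β : ℝ) (q : ℕ) : Prop :=
  (∀ i < q, Tendsto (iteratedDeriv i F) (𝓝[>] α) (𝓝 0) ∧
    Tendsto (iteratedDeriv i F) (𝓝[<] β) (𝓝 0)) ∧
  IntegrableAtFilter (iteratedDeriv q F) (𝓝[>] α) ∧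
  IntegrableAtFilter (iteratedDeriv q F) (𝓝[<] β)

/-- `I` is the Hadamard finite part of the integral over `(a, b)` of `u`, singular at the interior
point `t`: after discarding from the expansion of
`φ(ε) = ∫_a^{t-ε} u + ∫_{t+ε}^b u` finitely many divergent terms (negative integer powers of `ε`
and `log ε`), what remains tends to `I` as `ε → 0+`. -/
def HasFinitePart (u : ℝ → ℝ) (a t b I : ℝ) : Prop :=
  (∀ᶠ ε in 𝓝[>] (0 : ℝ), IntervalIntegrable u volume a (t - ε) ∧
    IntervalIntegrable u volume (t + ε) b) ∧
  ∃ (N : ℕ) (c : ℕ → ℝ) (d : ℝ),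
    Tendsto (fun ε : ℝ => ((∫ x in a..(t - ε), u x) + ∫ x in (t + ε)..b, u x) -
        ((∑ k ∈ Finset.range N, c k * (ε ^ (k + 1))⁻¹) + d * Real.log ε))
      (𝓝[>] 0) (𝓝 I)

/-- A combination of divergent terms that has a limit has limit zero. -/
theorem limit_divergent_eq_zero (c : ℕ → ℝ) (d : ℝ) (N : ℕ) (L : ℝ)
    (h : Tendsto (fun ε : ℝ => (∑ k ∈ Finset.range N, c k * (ε ^ (k + 1))⁻¹) + d * Real.log ε)
      (𝓝[>] 0) (𝓝 L)) : L = 0 := by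
  have hpow : ∀ n : ℕ, Tendsto (fun ε : ℝ => ε ^ (n + 1)) (𝓝[>] 0) (𝓝 0) := fun n => by
    have : Tendsto (fun ε : ℝ => ε ^ (n + 1)) (𝓝 0) (𝓝 (0 ^ (n + 1))) :=
      (continuous_pow (n + 1)).tendsto 0
    simpa using this.mono_left nhdsWithin_le_nhds
  induction N with
  | zero =>
    simp only [Finset.range_zero, Finset.sum_empty, zero_add] at h
    have hlog : Tendsto (fun ε : ℝ => (Real.log ε)⁻¹) (𝓝[>] 0) (𝓝 0) :=
      tendsto_inv_atBot_zero.comp Real.tendsto_log_nhdsGT_zero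
    have hd : d = 0 := by
      have h2 := h.mul hlog
      rw [mul_zero] at h2
      refine tendsto_nhds_unique (tendsto_const_nhds.congr' ?_) h2
      filter_upwards [Real.tendsto_log_nhdsGT_zero.eventually (eventually_lt_atBot (0 : ℝ))]
        with ε hε
      have : Real.log ε ≠ 0 := ne_of_lt hε
      field_simp
    subst hd
    simp only [zero_mul] at h
    exact tendsto_nhds_unique h tendsto_const_nhds
  | succ N ih =>
    have hc : c N = 0 := by
      have h1 : Tendsto (fun ε : ℝ => ((∑ k ∈ Finset.range (N + 1), c k * (ε ^ (k + 1))⁻¹) +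
          d * Real.log ε) * ε ^ (N + 1)) (𝓝[>] 0) (𝓝 0) := by
        simpa using h.mul (hpow N)
      have h2 : Tendsto (fun ε : ℝ => (∑ k ∈ Finset.range N, c k * ε ^ (N - 1 - k + 1)) + c N +
          d * (Real.log ε * ε ^ (N + 1))) (𝓝[>] 0) (𝓝 (c N)) := by
        have hs : Tendsto (fun ε : ℝ => ∑ k ∈ Finset.range N, c k * ε ^ (N - 1 - k + 1))
            (𝓝[>] 0) (𝓝 (∑ k ∈ Finset.range N, c k * 0)) :=
          tendsto_finsetSum _ fun k _ => (hpow _).const_mul _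
        have hl : Tendsto (fun ε : ℝ => Real.log ε * ε ^ (N + 1)) (𝓝[>] 0) (𝓝 0) := by
          have := tendsto_log_mul_rpow_nhdsGT_zero (r := ((N + 1 : ℕ) : ℝ)) (by positivity)
          simpa only [Real.rpow_natCast] using this
        simpa using (hs.add_const (c N)).add (hl.const_mul d)
      refine tendsto_nhds_unique h2 (h1.congr' ?_)
      filter_upwards [self_mem_nhdsWithin] with ε hε
      have hε : ε ≠ 0 := ne_of_gt hε
      rw [Finset.sum_range_succ, add_mul, add_mul, Finset.sum_mul, mul_assoc d]
      congr 2
      · refine Finset.sum_congr rfl fun k hk => ?_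
        have hk := Finset.mem_range.1 hk
        have e : N + 1 = (N - 1 - k + 1) + (k + 1) := by omega
        rw [e, pow_add _ (N - 1 - k + 1)]
        field_simp
      · field_simp
    refine ih (h.congr fun ε => ?_)
    rw [Finset.sum_range_succ, hc]
    ring

/-- The Hadamard finite part is unique. -/
theorem HasFinitePart.unique {u : ℝ → ℝ} {a t b I J : ℝ} (hI : HasFinitePart u a t b I)
    (hJ : HasFinitePart u a t b J) : I = J := by
  obtain ⟨-, N, c, d, hI⟩ := hI
  obtain ⟨-, M, c', d', hJ⟩ := hJ
  have key : ∀ (c : ℕ → ℝ) (N K : ℕ) (ε : ℝ), N ≤ K →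
      ∑ k ∈ Finset.range N, c k * (ε ^ (k + 1))⁻¹ =
      ∑ k ∈ Finset.range K, (if k < N then c k else 0) * (ε ^ (k + 1))⁻¹ := by
    intro c N K ε hNK
    rw [← Finset.sum_subset (Finset.range_mono hNK)]
    · exact Finset.sum_congr rfl fun k hk => by rw [if_pos (Finset.mem_range.1 hk)]
    · intro k _ hk
      rw [if_neg (by simpa using hk), zero_mul]
  have h := hJ.sub hI
  refine (sub_eq_zero.1 (limit_divergent_eq_zero
    (fun k => (if k < N then c k else 0) - (if k < M then c' k else 0)) (d - d') (max N M)
    (J - I) (h.congr fun ε => ?_))).symm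
  rw [key c N (max N M) ε (le_max_left _ _), key c' M (max N M) ε (le_max_right _ _)]
  simp only [sub_mul, Finset.sum_sub_distrib]
  ring

end

end PVTSI

/-! Subtract the pole. With `c_k = G^(k)(τ)/k!` and a bump `χ` supported close to `0`, write `F(ξ) =
W(ξ) + P(ξ - τ)`, where `P(y) = ∑_{k<m} c_k χ(y) y^(k-m)`. By Hadamard's lemma (`contDiffOn_dslope`,
iterated) `W` is smooth through `τ`, and it equals `F` near the endpoints, so it is still periodized
to order `q`.

For `W` the Euler–Maclaurin boundary terms cancel by periodicity, and the full trapezoidal sum has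
error `O(h^q)` (`exists_bound_trapezoid_periodicExtension`). The node `τ` is absent from the sum in
question; removing it costs `-c_m h = 2 ζ(0) c_m h`, which is the last term of the expansion.

For `P` the nodes on the two sides of `τ` are mirror images, so odd inverse powers cancel and even
ones double. For even `s`, `h ∑ χ(jh)(jh)^(-s)` is `ζ(s) h^(1-s)` minus the same sum for `(1 - χ(x))
x^(-s)`. That function is smooth, flat at `0` and decaying, so Euler–Maclaurin on `[0, ∞)` replaces
its sum by its integral `cutoffConst χ s` up to `O(h^q)` (`exists_bound_sum_bump_mul_zpow`). The
finite part of `∫ χ(x) x^(-s)` over the half line is `-cutoffConst χ s`, because `x^(-s)` itself has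
finite part zero; hence the constants produced by the sums are exactly those in `I[F]`
(`hasFinitePart_of_eq_div`).

Independence of `t` and `m`: near an endpoint two transformed integrands differ by the factor `(ψ -
t)^m / (ψ - t₁)^m₁`, which is `C^k` up to the endpoint, and Leibniz's rule shows that such a factor
preserves periodization (`PeriodizedAlong.mul`). -/

namespace PVTSI

/-! ### Euler–Maclaurin estimate through Bernoulli kernels. -/

/-- The Bernoulli polynomial `B_k` divided by `k!`, as a function on `ℝ`. -/
noncomputable def bernoulliKernel (k : ℕ) (x : ℝ) : ℝ := bernoulliFun k x / (k ! : ℝ)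

theorem continuous_bernoulliKernel (k : ℕ) : Continuous (bernoulliKernel k) :=
  (continuous_bernoulliFun k).div_const _

theorem hasDerivAt_bernoulliKernel (k : ℕ) (x : ℝ) :
    HasDerivAt (bernoulliKernel (k + 1)) (bernoulliKernel k x) x := by
  have h := (hasDerivAt_bernoulliFun (k + 1) x).div_const ((k + 1)! : ℝ)
  refine h.congr_deriv ?_
  rw [Nat.factorial_succ, Nat.add_sub_cancel]
  unfold bernoulliKernel
  have : (k ! : ℝ) ≠ 0 := by positivity
  have : ((k + 1 : ℕ) : ℝ) ≠ 0 := by positivity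
  push_cast at *
  field_simp

theorem exists_bound_bernoulliKernel (q : ℕ) :
    ∃ C : ℝ, 0 ≤ C ∧ ∀ k ≤ q, ∀ x ∈ Icc (0 : ℝ) 1, |bernoulliKernel k x| ≤ C := by
  induction q with
  | zero =>
    obtain ⟨C, hC⟩ := isCompact_Icc.exists_bound_of_continuousOn
      (continuous_bernoulliKernel 0).continuousOn (s := Icc (0 : ℝ) 1)
    refine ⟨max C 0, le_max_right _ _, fun k hk x hx => ?_⟩
    obtain rfl : k = 0 := by omega
    exact (hC x hx).trans (le_max_left _ _)
  | succ q ih =>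
    obtain ⟨C, hC0, hC⟩ := ih
    obtain ⟨D, hD⟩ := isCompact_Icc.exists_bound_of_continuousOn
      (continuous_bernoulliKernel (q + 1)).continuousOn (s := Icc (0 : ℝ) 1)
    refine ⟨max C D, hC0.trans (le_max_left _ _), fun k hk x hx => ?_⟩
    rcases hk.lt_or_eq with h | rfl
    · exact (hC k (by omega) x hx).trans (le_max_left _ _)
    · exact (hD x hx).trans (le_max_right _ _)

/-- Integration by parts against the Bernoulli kernel over one cell of length `h`. -/
theorem integral_cell_add_integral_cell {u u' : ℝ → ℝ} {x₀ h : ℝ} (hh : 0 < h) {S : Set ℝ}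
    (hS : S.Countable) (hu : ContinuousOn u (Icc x₀ (x₀ + h)))
    (hu' : ∀ x ∈ Ioo x₀ (x₀ + h) \ S, HasDerivAt u (u' x) x)
    (hi : IntervalIntegrable u' volume x₀ (x₀ + h)) (k : ℕ) :
    (∫ x in x₀..(x₀ + h), h ^ k * (u x * bernoulliKernel k ((x - x₀) / h))) +
      (∫ x in x₀..(x₀ + h), h ^ (k + 1) * (u' x * bernoulliKernel (k + 1) ((x - x₀) / h))) =
      h ^ (k + 1) * (u (x₀ + h) * bernoulliKernel (k + 1) 1 -
        u x₀ * bernoulliKernel (k + 1) 0) := by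
  have hle : x₀ ≤ x₀ + h := by linarith
  have hcont : ∀ k, Continuous fun x => bernoulliKernel k ((x - x₀) / h) := fun k =>
    (continuous_bernoulliKernel k).comp (by fun_prop)
  have hi1 : IntervalIntegrable (fun x => h ^ k * (u x * bernoulliKernel k ((x - x₀) / h)))
      volume x₀ (x₀ + h) := by
    apply ContinuousOn.intervalIntegrable
    rw [uIcc_of_le hle]
    exact continuousOn_const.mul (hu.mul (hcont k).continuousOn)
  have hi2 : IntervalIntegrable
      (fun x => h ^ (k + 1) * (u' x * bernoulliKernel (k + 1) ((x - x₀) / h)))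
      volume x₀ (x₀ + h) := (hi.mul_continuousOn (hcont _).continuousOn).const_mul _
  rw [← intervalIntegral.integral_add hi1 hi2]
  rw [integral_eq_of_hasDerivAt_off_countable_of_le
    (fun x => h ^ (k + 1) * (u x * bernoulliKernel (k + 1) ((x - x₀) / h))) _ hle hS
    (continuousOn_const.mul (hu.mul (hcont _).continuousOn)) ?_ (hi1.add hi2)]
  · have e1 : (x₀ + h - x₀) / h = 1 := by field_simp; ring
    simp only [e1, sub_self, zero_div]
    ring
  · intro x hx
    have h1 : HasDerivAt (fun x => bernoulliKernel (k + 1) ((x - x₀) / h))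
        (bernoulliKernel k ((x - x₀) / h) * (1 / h)) x :=
      (hasDerivAt_bernoulliKernel k _).comp x (((hasDerivAt_id x).sub_const x₀).div_const h)
    refine (((hu' x hx).mul h1).const_mul (h ^ (k + 1))).congr_deriv ?_
    rw [pow_succ]
    field_simp
    ring

theorem bernoulliKernel_one_one : bernoulliKernel 1 1 = 1 / 2 := by
  simp [bernoulliKernel]; norm_num

theorem bernoulliKernel_one_zero : bernoulliKernel 1 0 = -(1 / 2) := by
  simp [bernoulliKernel]

/-- Equality of the endpoint values makes the boundary terms of order at least two telescope across
cells; only `B_1` jumps. -/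
theorem bernoulliKernel_add_two_one (k : ℕ) :
    bernoulliKernel (k + 2) 1 = bernoulliKernel (k + 2) 0 := by
  rw [bernoulliKernel, bernoulliKernel, bernoulliFun_endpoints_eq_of_ne_one (by omega)]

/-- Euler–Maclaurin estimate: `U i` are successive derivatives, off a countable set, and the last
one is only assumed integrable. -/
theorem exists_eulerMaclaurin_bound (q : ℕ) (hq : 1 ≤ q) :
    ∃ C : ℝ, 0 ≤ C ∧ ∀ (U : ℕ → ℝ → ℝ) (N : ℕ) (h : ℝ) (S : Set ℝ), 0 < h → S.Countable →
      (∀ i < q, ContinuousOn (U i) (Icc 0 (N * h))) →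
      (∀ i < q, ∀ x ∈ Ioo 0 (N * h) \ S, HasDerivAt (U i) (U (i + 1) x) x) →
      IntervalIntegrable (U q) volume 0 (N * h) →
      |h * ∑ j ∈ Finset.range N, U 0 (j * h) - ∫ x in (0 : ℝ)..(N * h), U 0 x| ≤
        C * ((∑ i ∈ Finset.range q, h ^ (i + 1) * |U i (N * h) - U i 0|) +
          h ^ q * ∫ x in (0 : ℝ)..(N * h), |U q x|) := by
  obtain ⟨C, hC0, hC⟩ := exists_bound_bernoulliKernel q
  refine ⟨C, hC0, fun U N h S hh hS hc hd hi => ?_⟩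
  have hnode : ∀ j : ℕ, ((j + 1 : ℕ) : ℝ) * h = j * h + h := fun j => by push_cast; ring
  have hsub : ∀ j < N, Icc ((j : ℝ) * h) (j * h + h) ⊆ Icc 0 (N * h) := by
    intro j hj
    refine Icc_subset_Icc (by positivity) ?_
    rw [← hnode]
    exact mul_le_mul_of_nonneg_right (by exact_mod_cast hj) hh.le
  have hsub' : ∀ j < N, Ioo ((j : ℝ) * h) (j * h + h) ⊆ Ioo 0 (N * h) := by
    intro j hj
    refine Ioo_subset_Ioo (by positivity) ?_
    rw [← hnode]
    exact mul_le_mul_of_nonneg_right (by exact_mod_cast hj) hh.le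
  have hle : ∀ j : ℕ, (j : ℝ) * h ≤ j * h + h := fun j => by linarith
  have h0N : (0 : ℝ) ≤ N * h := by positivity
  have hint : ∀ i ≤ q, IntervalIntegrable (U i) volume 0 (N * h) := by
    intro i hiq
    rcases hiq.lt_or_eq with h1 | rfl
    · apply ContinuousOn.intervalIntegrable
      rw [uIcc_of_le h0N]
      exact hc i h1
    · exact hi
  have hintj : ∀ i ≤ q, ∀ j < N, IntervalIntegrable (U i) volume (j * h) (j * h + h) := by
    intro i hiq j hj
    refine (hint i hiq).mono_set ?_
    rw [uIcc_of_le (hle j), uIcc_of_le h0N]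
    exact hsub j hj
  -- `T 0` is the integral and `T q` the final remainder; each integration by parts expresses `T k +
  -- T (k + 1)` by boundary values.
  set T : ℕ → ℝ := fun k => ∑ j ∈ Finset.range N, ∫ x in (j * h : ℝ)..(j * h + h),
    h ^ k * (U k x * bernoulliKernel k ((x - j * h) / h)) with hT
  have hT0 : T 0 = ∫ x in (0 : ℝ)..(N * h), U 0 x := by
    have hb : ∀ x, bernoulliKernel 0 x = 1 := fun x => by simp [bernoulliKernel]
    have := intervalIntegral.sum_integral_adjacent_intervals (f := U 0) (μ := volume)
      (a := fun j : ℕ => (j : ℝ) * h) (n := N) (fun j hj => by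
        rw [hnode]; exact hintj 0 (Nat.zero_le _) j hj)
    simp only [hnode, Nat.cast_zero, zero_mul] at this
    simp only [hT, hb, pow_zero, one_mul, mul_one, this]
  have hstep : ∀ k < q, T k + T (k + 1) = ∑ j ∈ Finset.range N,
      h ^ (k + 1) * (U k (j * h + h) * bernoulliKernel (k + 1) 1 -
        U k (j * h) * bernoulliKernel (k + 1) 0) := by
    intro k hk
    simp only [hT, ← Finset.sum_add_distrib]
    refine Finset.sum_congr rfl fun j hj => ?_
    have hj := Finset.mem_range.1 hj
    exact integral_cell_add_integral_cell hh hS ((hc k hk).mono (hsub j hj))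
      (fun x hx => hd k hk x ⟨hsub' j hj hx.1, hx.2⟩) (hintj (k + 1) hk j hj) k
  have htel : ∀ k, ∑ j ∈ Finset.range N, (U k (j * h + h) - U k (j * h)) =
      U k (N * h) - U k 0 := by
    intro k
    have := Finset.sum_range_sub (fun j : ℕ => U k (j * h)) N
    simpa only [hnode, Nat.cast_zero, zero_mul] using this
  have hstep' : ∀ k, k + 1 < q → T (k + 1) + T (k + 2) =
      h ^ (k + 2) * (bernoulliKernel (k + 2) 0 * (U (k + 1) (N * h) - U (k + 1) 0)) := by
    intro k hk
    rw [hstep (k + 1) hk, ← htel, Finset.mul_sum, Finset.mul_sum]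
    refine Finset.sum_congr rfl fun j _ => ?_
    rw [bernoulliKernel_add_two_one]
    ring
  -- The values `±1/2` of `B_1` give the symmetric trapezoidal sum; passing to the left-endpoint sum
  -- costs half of `U 0 (N * h) - U 0 0`.
  have hfirst : h * ∑ j ∈ Finset.range N, U 0 (j * h) - T 0 =
      T 1 + h * (bernoulliKernel 1 0 * (U 0 (N * h) - U 0 0)) := by
    have h1 := hstep 0 hq
    have h2 : ∑ j ∈ Finset.range N, h ^ (0 + 1) * (U 0 (j * h + h) * bernoulliKernel (0 + 1) 1 -
        U 0 (j * h) * bernoulliKernel (0 + 1) 0) =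
        h * ∑ j ∈ Finset.range N, U 0 (j * h) + h * (1 / 2 * (U 0 (N * h) - U 0 0)) := by
      rw [← htel, Finset.mul_sum, Finset.mul_sum, Finset.mul_sum, ← Finset.sum_add_distrib]
      refine Finset.sum_congr rfl fun j _ => ?_
      rw [bernoulliKernel_one_one, bernoulliKernel_one_zero]
      ring
    rw [h2] at h1
    rw [bernoulliKernel_one_zero]
    linarith
  have hTq : |T q| ≤ C * (h ^ q * ∫ x in (0 : ℝ)..(N * h), |U q x|) := by
    have hadj := intervalIntegral.sum_integral_adjacent_intervals (f := fun x => |U q x|)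
      (μ := volume) (a := fun j : ℕ => (j : ℝ) * h) (n := N) (fun j hj => by
        rw [hnode]; exact (hintj q le_rfl j hj).abs)
    simp only [hnode, Nat.cast_zero, zero_mul] at hadj
    rw [← hadj, Finset.mul_sum, Finset.mul_sum]
    refine (Finset.abs_sum_le_sum_abs _ _).trans (Finset.sum_le_sum fun j hj => ?_)
    have hj := Finset.mem_range.1 hj
    rw [← intervalIntegral.integral_const_mul, ← intervalIntegral.integral_const_mul,
      ← Real.norm_eq_abs]
    refine intervalIntegral.norm_integral_le_of_norm_le (hle j) ?_
      (((hintj q le_rfl j hj).abs.const_mul _).const_mul _)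
    refine ae_of_all _ fun x hx => ?_
    have hk : |bernoulliKernel q ((x - j * h) / h)| ≤ C := by
      refine hC q le_rfl _ ⟨div_nonneg (by linarith [hx.1]) hh.le, ?_⟩
      rw [div_le_one hh]
      linarith [hx.2]
    rw [Real.norm_eq_abs, abs_mul, abs_mul, abs_of_pos (pow_pos hh q)]
    have : |U q x| * |bernoulliKernel q ((x - j * h) / h)| ≤ |U q x| * C :=
      mul_le_mul_of_nonneg_left hk (abs_nonneg _)
    nlinarith [pow_pos hh q]
  have hind : ∀ k, 1 ≤ k → k ≤ q → |h * ∑ j ∈ Finset.range N, U 0 (j * h) - T 0| ≤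
      C * (∑ i ∈ Finset.range k, h ^ (i + 1) * |U i (N * h) - U i 0|) + |T k| := by
    have hb : ∀ i < q, |h ^ (i + 1) * (bernoulliKernel (i + 1) 0 * (U i (N * h) - U i 0))| ≤
        C * (h ^ (i + 1) * |U i (N * h) - U i 0|) := by
      intro i hi
      rw [abs_mul, abs_mul, abs_of_pos (pow_pos hh _)]
      have := hC (i + 1) hi 0 ⟨le_rfl, zero_le_one⟩
      have h2 : |bernoulliKernel (i + 1) 0| * |U i (N * h) - U i 0| ≤
        C * |U i (N * h) - U i 0| := mul_le_mul_of_nonneg_right this (abs_nonneg _)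
      nlinarith [pow_pos hh (i + 1)]
    intro k hk1
    induction k, hk1 using Nat.le_induction with
    | base =>
      intro _
      have := hb 0 hq
      rw [zero_add, pow_one] at this
      rw [hfirst, Finset.sum_range_one, zero_add, pow_one]
      exact (abs_add_le _ _).trans (by linarith)
    | succ k hk1 ih =>
      intro hkq
      have h1 := ih (by omega)
      obtain ⟨k, rfl⟩ : ∃ l, k = l + 1 := ⟨k - 1, by omega⟩
      have h2 := hstep' k (by omega)
      have h3 := hb (k + 1) (by omega)
      rw [← h2] at h3
      have h4 : |T (k + 1)| ≤ |T (k + 1) + T (k + 2)| + |T (k + 2)| := by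
        have := abs_sub (T (k + 1) + T (k + 2)) (T (k + 2))
        rwa [add_sub_cancel_right] at this
      rw [Finset.sum_range_succ, mul_add]
      linarith
  have := hind q hq le_rfl
  rw [← hT0, mul_add]
  linarith

/-! ### Sums and integrals of cut-off inverse powers. -/

/-- The function `(1 - χ(x)) x^(-s)`: an inverse power with its singularity at `0` cut off. -/
noncomputable def cutoffPow (χ : ContDiffBump (0 : ℝ)) (s : ℕ) (x : ℝ) : ℝ :=
  (1 - χ x) * x ^ (-(s : ℤ))

theorem cutoffPow_of_abs_le (χ : ContDiffBump (0 : ℝ)) (s : ℕ) {x : ℝ} (hx : |x| ≤ χ.rIn) :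
    cutoffPow χ s x = 0 := by
  rw [cutoffPow, χ.one_of_mem_closedBall (by simpa using hx), sub_self, zero_mul]

theorem bump_eq_zero (χ : ContDiffBump (0 : ℝ)) {x : ℝ} (hx : χ.rOut ≤ |x|) : χ x = 0 :=
  χ.zero_of_le_dist (by simpa [Real.dist_eq] using hx)

theorem cutoffPow_of_le (χ : ContDiffBump (0 : ℝ)) (s : ℕ) {x : ℝ} (hx : χ.rOut ≤ x) :
    cutoffPow χ s x = x ^ (-(s : ℤ)) := by
  rw [cutoffPow, bump_eq_zero χ (hx.trans (le_abs_self x)), sub_zero, one_mul]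

theorem contDiff_cutoffPow (χ : ContDiffBump (0 : ℝ)) (s : ℕ) :
    ContDiff ℝ ∞ (cutoffPow χ s) := by
  rw [contDiff_iff_contDiffAt]
  intro x
  rcases eq_or_ne x 0 with rfl | hx
  · have : cutoffPow χ s =ᶠ[𝓝 0] fun _ => 0 := by
      filter_upwards [Metric.closedBall_mem_nhds (0 : ℝ) χ.rIn_pos] with y hy
      exact cutoffPow_of_abs_le χ s (by simpa using hy)
    exact contDiffAt_const.congr_of_eventuallyEq this
  · refine (contDiffAt_const.sub χ.contDiffAt).mul ?_
    simp only [zpow_neg, zpow_natCast]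
    exact (contDiffAt_id.pow s).inv (pow_ne_zero _ hx)

theorem iteratedDeriv_cutoffPow_zero (χ : ContDiffBump (0 : ℝ)) (s i : ℕ) :
    iteratedDeriv i (cutoffPow χ s) 0 = 0 := by
  have : cutoffPow χ s =ᶠ[𝓝 0] fun _ => 0 := by
    filter_upwards [Metric.closedBall_mem_nhds (0 : ℝ) χ.rIn_pos] with y hy
    exact cutoffPow_of_abs_le χ s (by simpa using hy)
  rw [this.iteratedDeriv_eq, iteratedDeriv_fun_const_zero]

theorem iteratedDeriv_cutoffPow_of_lt (χ : ContDiffBump (0 : ℝ)) (s i : ℕ) {x : ℝ}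
    (hx : χ.rOut < x) : iteratedDeriv i (cutoffPow χ s) x =
      (∏ j ∈ Finset.range i, ((-(s : ℤ) : ℤ) - j : ℝ)) * x ^ (-(s : ℤ) - i) := by
  have : EqOn (cutoffPow χ s) (fun x => x ^ (-(s : ℤ))) (Ioi χ.rOut) := fun y hy =>
    cutoffPow_of_le χ s (le_of_lt hy)
  rw [this.iteratedDeriv_of_isOpen isOpen_Ioi i hx, iteratedDeriv_eq_iterate, iter_deriv_zpow]

theorem continuous_iteratedDeriv_cutoffPow (χ : ContDiffBump (0 : ℝ)) (s i : ℕ) :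
    Continuous (iteratedDeriv i (cutoffPow χ s)) :=
  (contDiff_cutoffPow χ s).continuous_iteratedDeriv i (by exact_mod_cast le_top)

theorem tendsto_iteratedDeriv_cutoffPow (χ : ContDiffBump (0 : ℝ)) {s : ℕ} (hs : 2 ≤ s) (i : ℕ) :
    Tendsto (iteratedDeriv i (cutoffPow χ s)) atTop (𝓝 0) := by
  have h1 : Tendsto (fun x : ℝ => x ^ (-(s : ℤ) - i)) atTop (𝓝 0) := by
    have := tendsto_pow_neg_atTop (𝕜 := ℝ) (n := s + i) (by omega)
    refine this.congr fun x => ?_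
    congr 1
    push_cast
    ring
  have h2 := h1.const_mul (∏ j ∈ Finset.range i, ((-(s : ℤ) : ℤ) - j : ℝ))
  rw [mul_zero] at h2
  refine h2.congr' ?_
  filter_upwards [eventually_gt_atTop χ.rOut] with x hx
  rw [iteratedDeriv_cutoffPow_of_lt χ s i hx]

theorem integrableOn_iteratedDeriv_cutoffPow (χ : ContDiffBump (0 : ℝ)) {s : ℕ} (hs : 2 ≤ s)
    (i : ℕ) : IntegrableOn (iteratedDeriv i (cutoffPow χ s)) (Ioi 0) := by
  have h0 := χ.rOut_pos
  have hR : (0 : ℝ) ≤ χ.rOut + 1 := by linarith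
  rw [← Ioc_union_Ioi_eq_Ioi hR]
  refine IntegrableOn.union ?_ ?_
  · exact ((continuous_iteratedDeriv_cutoffPow χ s i).integrableOn_Icc).mono_set Ioc_subset_Icc_self
  · have h1 : IntegrableOn (fun x : ℝ => x ^ (-(s : ℝ) - i)) (Ioi (χ.rOut + 1)) := by
      refine integrableOn_Ioi_rpow_of_lt ?_ (by linarith)
      have : (2 : ℝ) ≤ s := by exact_mod_cast hs
      have : (0 : ℝ) ≤ i := i.cast_nonneg
      linarith
    refine IntegrableOn.congr_fun
      (h1.const_mul (∏ j ∈ Finset.range i, ((-(s : ℤ) : ℤ) - j : ℝ))) (fun x hx => ?_)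
      measurableSet_Ioi
    have hx' : χ.rOut + 1 < x := hx
    rw [iteratedDeriv_cutoffPow_of_lt χ s i (by linarith), ← Real.rpow_intCast]
    push_cast
    rfl

theorem integral_cutoffPow (χ : ContDiffBump (0 : ℝ)) {s : ℕ} (hs : 2 ≤ s) {X : ℝ}
    (hX : χ.rOut ≤ X) : ∫ x in (0 : ℝ)..X, cutoffPow χ s x =
      (∫ x in (0 : ℝ)..χ.rOut, cutoffPow χ s x) - χ.rOut ^ (-(s : ℤ) + 1) / (-(s : ℝ) + 1) +
        X ^ (-(s : ℤ) + 1) / (-(s : ℝ) + 1) := by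
  have hc := (contDiff_cutoffPow χ s).continuous
  have h0 := χ.rOut_pos
  rw [← intervalIntegral.integral_add_adjacent_intervals (hc.intervalIntegrable 0 χ.rOut)
    (hc.intervalIntegrable χ.rOut X)]
  have h1 : ∫ x in χ.rOut..X, cutoffPow χ s x = ∫ x in χ.rOut..X, x ^ (-(s : ℤ)) := by
    refine intervalIntegral.integral_congr fun x hx => ?_
    rw [uIcc_of_le hX] at hx
    exact cutoffPow_of_le χ s hx.1
  have h2 : (0 : ℝ) ∉ uIcc χ.rOut X := by
    rw [uIcc_of_le hX]
    exact fun h => absurd h.1 (not_le.2 h0)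
  rw [h1, integral_zpow (Or.inr ⟨by omega, h2⟩)]
  push_cast
  ring

/-- The finite part over `(0, ∞)` of the cut-off inverse power, up to sign. -/
noncomputable def cutoffConst (χ : ContDiffBump (0 : ℝ)) (s : ℕ) : ℝ :=
  (∫ x in (0 : ℝ)..χ.rOut, cutoffPow χ s x) - χ.rOut ^ (-(s : ℤ) + 1) / (-(s : ℝ) + 1)

/-- Writing `χ x^(-s)` as `x^(-s)` minus the cut-off power, the contributions at `X` cancel. What is
left besides the divergent term is minus the constant that the trapezoidal sums produce. -/
theorem integral_bump_mul_zpow (χ : ContDiffBump (0 : ℝ)) {s : ℕ} (hs : 2 ≤ s) {ε X : ℝ}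
    (hε : 0 < ε) (hε' : ε ≤ χ.rIn) (hX : χ.rOut ≤ X) :
    ∫ x in ε..X, χ x * x ^ (-(s : ℤ)) =
      -(ε ^ (-(s : ℤ) + 1) / (-(s : ℝ) + 1)) - cutoffConst χ s := by
  have hc := (contDiff_cutoffPow χ s).continuous
  have hεX : ε ≤ X := hε'.trans (χ.rIn_lt_rOut.le.trans hX)
  have h2 : (0 : ℝ) ∉ uIcc ε X := by
    rw [uIcc_of_le hεX]
    exact fun h => absurd h.1 (not_le.2 hε)
  have h1 : ∫ x in ε..X, χ x * x ^ (-(s : ℤ)) =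
      (∫ x in ε..X, x ^ (-(s : ℤ))) - ∫ x in ε..X, cutoffPow χ s x := by
    rw [← intervalIntegral.integral_sub
      (intervalIntegral.intervalIntegrable_zpow (Or.inr h2)) (hc.intervalIntegrable _ _)]
    refine intervalIntegral.integral_congr fun x _ => ?_
    simp only [cutoffPow]
    ring
  have h3 : ∫ x in (0 : ℝ)..ε, cutoffPow χ s x = 0 := by
    rw [intervalIntegral.integral_congr (g := fun _ => (0 : ℝ)), intervalIntegral.integral_zero]
    intro x hx
    rw [uIcc_of_le hε.le] at hx
    exact cutoffPow_of_abs_le χ s (by rw [abs_of_nonneg hx.1]; exact hx.2.trans hε')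
  have h4 := intervalIntegral.integral_add_adjacent_intervals (hc.intervalIntegrable 0 ε)
    (hc.intervalIntegrable (μ := volume) ε X)
  rw [h3, zero_add, integral_cutoffPow χ hs hX] at h4
  rw [h1, h4, integral_zpow (Or.inr ⟨by omega, h2⟩), cutoffConst]
  push_cast
  ring

/-- Euler–Maclaurin expansion of the sum of a cut-off inverse power. -/
theorem exists_bound_sum_bump_mul_zpow (χ : ContDiffBump (0 : ℝ)) {s : ℕ} (hs : 2 ≤ s) {q : ℕ}
    (hq : 1 ≤ q) : ∃ K : ℝ, ∀ (h : ℝ) (n : ℕ), 0 < h → χ.rOut ≤ n * h →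
      |h * ∑ j ∈ Finset.Ico 1 n, χ (j * h) * (j * h) ^ (-(s : ℤ)) -
        ((riemannZeta s).re * h ^ (-(s : ℤ) + 1) - cutoffConst χ s)| ≤ K * h ^ q := by
  obtain ⟨C, hC0, hC⟩ := exists_eulerMaclaurin_bound q hq
  set K' := ∫ x in Ioi (0 : ℝ), |iteratedDeriv q (cutoffPow χ s) x| with hK'
  refine ⟨C * K', fun h n hh hn => ?_⟩
  have hint := (integrableOn_iteratedDeriv_cutoffPow χ hs q).abs
  have hcast : Tendsto (fun N : ℕ => (N : ℝ) * h) atTop atTop :=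
    tendsto_natCast_atTop_atTop.atTop_mul_const hh
  have hbound : ∀ N : ℕ, |h * ∑ j ∈ Finset.range N, cutoffPow χ s (j * h) -
      ∫ x in (0 : ℝ)..(N * h), cutoffPow χ s x| ≤
      C * ((∑ i ∈ Finset.range q, h ^ (i + 1) * |iteratedDeriv i (cutoffPow χ s) (N * h)|) +
        h ^ q * K') := by
    intro N
    have h1 := hC (fun i => iteratedDeriv i (cutoffPow χ s)) N h ∅ hh countable_empty
      (fun i _ => (continuous_iteratedDeriv_cutoffPow χ s i).continuousOn)
      (fun i _ x _ => by
        rw [iteratedDeriv_succ]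
        exact ((contDiff_cutoffPow χ s).differentiable_iteratedDeriv i
          (by exact_mod_cast WithTop.coe_lt_top _) x).hasDerivAt)
      ((continuous_iteratedDeriv_cutoffPow χ s q).intervalIntegrable _ _)
    simp only [iteratedDeriv_cutoffPow_zero, sub_zero, iteratedDeriv_zero] at h1
    refine h1.trans (mul_le_mul_of_nonneg_left ?_ hC0)
    have h2 : ∫ x in (0 : ℝ)..(N * h), |iteratedDeriv q (cutoffPow χ s) x| ≤ K' := by
      rw [intervalIntegral.integral_of_le (by positivity)]
      exact setIntegral_mono_set hint (ae_of_all _ fun _ => abs_nonneg _)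
        (Ioc_subset_Ioi_self.eventuallyLE)
    have := mul_le_mul_of_nonneg_left h2 (pow_pos hh q).le
    linarith
  have hlimr : Tendsto (fun N : ℕ => C * ((∑ i ∈ Finset.range q,
      h ^ (i + 1) * |iteratedDeriv i (cutoffPow χ s) (N * h)|) + h ^ q * K')) atTop
      (𝓝 (C * ((∑ i ∈ Finset.range q, h ^ (i + 1) * |(0 : ℝ)|) + h ^ q * K'))) := by
    refine ((tendsto_finsetSum _ fun i _ => ?_).add_const _).const_mul _
    exact (((tendsto_iteratedDeriv_cutoffPow χ hs i).comp hcast).abs).const_mul _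
  have hlimi : Tendsto (fun N : ℕ => ∫ x in (0 : ℝ)..(N * h), cutoffPow χ s x) atTop
      (𝓝 (cutoffConst χ s)) := by
    have h1 : Tendsto (fun x : ℝ => cutoffConst χ s + x ^ (-(s : ℤ) + 1) / (-(s : ℝ) + 1)) atTop
        (𝓝 (cutoffConst χ s + 0 / (-(s : ℝ) + 1))) := by
      refine (Tendsto.div_const ?_ _).const_add _
      have := tendsto_pow_neg_atTop (𝕜 := ℝ) (n := s - 1) (by omega)
      refine this.congr fun x => ?_
      congr 1
      omega
    rw [zero_div, add_zero] at h1
    refine (h1.comp hcast).congr' ?_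
    filter_upwards [hcast.eventually_ge_atTop χ.rOut] with N hN
    rw [integral_cutoffPow χ hs hN]
    rfl
  -- The term `j = 0` is `0⁻¹ = 0`, so starting the range at `0` does no harm.
  have hsum : Tendsto (fun N : ℕ => ∑ j ∈ Finset.range N, ((j : ℝ) ^ s)⁻¹) atTop
      (𝓝 (riemannZeta s).re) := by
    have h1 : Summable fun j : ℕ => ((j : ℝ) ^ s)⁻¹ := Real.summable_nat_pow_inv.2 (by omega)
    have h2 : (riemannZeta s).re = ∑' j : ℕ, ((j : ℝ) ^ s)⁻¹ := by
      rw [zeta_nat_eq_tsum_of_gt_one (by omega), ← Complex.ofReal_re (∑' j : ℕ, ((j : ℝ) ^ s)⁻¹)]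
      push_cast
      simp only [one_div]
    rw [h2]
    exact h1.hasSum.tendsto_sum_nat
  have hlims : Tendsto (fun N : ℕ => h * ∑ j ∈ Finset.range N, cutoffPow χ s (j * h)) atTop
      (𝓝 ((riemannZeta s).re * h ^ (-(s : ℤ) + 1) -
        h * ∑ j ∈ Finset.Ico 1 n, χ (j * h) * (j * h) ^ (-(s : ℤ)))) := by
    have h1 := (hsum.mul_const (h ^ (-(s : ℤ) + 1))).sub_const
      (h * ∑ j ∈ Finset.Ico 1 n, χ (j * h) * (j * h) ^ (-(s : ℤ)))
    refine h1.congr' ?_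
    filter_upwards [eventually_ge_atTop n] with N hN
    have h2 : ∑ j ∈ Finset.Ico 1 n, χ (j * h) * (j * h) ^ (-(s : ℤ)) =
        ∑ j ∈ Finset.range N, χ (j * h) * (j * h) ^ (-(s : ℤ)) := by
      refine Finset.sum_subset (fun j hj => ?_) fun j _ hj => ?_
      · rw [Finset.mem_Ico] at hj
        exact Finset.mem_range.2 (by omega)
      · rw [Finset.mem_Ico, not_and_or, not_le, not_lt] at hj
        rcases hj with hj | hj
        -- Here `χ 0 = 1`, and the term vanishes only because `0 ^ (-s) = 0` by convention.
        · obtain rfl : j = 0 := by omega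
          rw [Nat.cast_zero, zero_mul, zero_zpow _ (by omega), mul_zero]
        · have : χ.rOut ≤ j * h := hn.trans
            (mul_le_mul_of_nonneg_right (by exact_mod_cast hj) hh.le)
          rw [bump_eq_zero χ (this.trans (le_abs_self _)), zero_mul]
    rw [h2, Finset.sum_mul, Finset.mul_sum, Finset.mul_sum, ← Finset.sum_sub_distrib]
    refine Finset.sum_congr rfl fun j _ => ?_
    rw [cutoffPow, mul_zpow, zpow_add₀ hh.ne', zpow_one, zpow_neg (j : ℝ), zpow_natCast]
    ring
  have := le_of_tendsto_of_tendsto' (hlims.sub hlimi).abs hlimr hbound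
  rw [← abs_neg]
  simp only [abs_zero, mul_zero, Finset.sum_const_zero, zero_add] at this
  calc _ = _ := by congr 1; ring
    _ ≤ _ := this
    _ = _ := by ring

/-! ### Divided differences of smooth functions. -/

/-- Differentiating under the integral turns `(k, f)` into `(k + 1, f')`; the weight `s ^ k` is
there so that the induction on `n` closes. -/
theorem contDiff_integral_pow_mul_comp (c : ℝ) (n : ℕ) : ∀ (k : ℕ) (f : ℝ → ℝ), ContDiff ℝ ∞ f →
    ContDiff ℝ n fun x => ∫ s in (0 : ℝ)..1, s ^ k * f (c + s * (x - c)) := by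
  induction n with
  | zero =>
    intro k f hf
    have := hf.continuous
    exact contDiff_zero.2 (intervalIntegral.continuous_parametric_intervalIntegral_of_continuous'
      (by fun_prop) _ _)
  | succ n ih =>
    intro k f hf
    have hfc := hf.continuous
    have hf' : ContDiff ℝ ∞ (deriv f) := hf.deriv'
    have hf'c := hf'.continuous
    have key : ∀ x₀, HasDerivAt (fun x => ∫ s in (0 : ℝ)..1, s ^ k * f (c + s * (x - c)))
        (∫ s in (0 : ℝ)..1, s ^ (k + 1) * deriv f (c + s * (x₀ - c))) x₀ := by
      intro x₀
      have hcont2 : Continuous fun p : ℝ × ℝ => p.2 ^ (k + 1) * deriv f (c + p.2 * (p.1 - c)) := by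
        fun_prop
      obtain ⟨C, hC⟩ := ((isCompact_closedBall x₀ 1).prod
        (isCompact_Icc (a := (0 : ℝ)) (b := 1))).exists_bound_of_continuousOn hcont2.continuousOn
      refine (intervalIntegral.hasDerivAt_integral_of_dominated_loc_of_deriv_le
        (F' := fun x s => s ^ (k + 1) * deriv f (c + s * (x - c))) (bound := fun _ => C)
        (Metric.closedBall_mem_nhds x₀ one_pos) (Eventually.of_forall fun x => ?_) ?_ ?_ ?_ ?_ ?_).2
      · exact (Continuous.aestronglyMeasurable (by fun_prop))
      · exact (Continuous.intervalIntegrable (by fun_prop) _ _)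
      · exact (Continuous.aestronglyMeasurable (by fun_prop))
      · refine ae_of_all _ fun t ht x hx => hC (x, t) ⟨hx, ?_⟩
        rw [uIoc_of_le zero_le_one] at ht
        exact Ioc_subset_Icc_self ht
      · exact intervalIntegrable_const
      · refine ae_of_all _ fun t _ x _ => ?_
        have h1 : HasDerivAt (fun x : ℝ => c + t * (x - c)) (t * 1) x :=
          (((hasDerivAt_id x).sub_const c).const_mul t).const_add c
        have h2 := ((hf.differentiable (by simp) (c + t * (x - c))).hasDerivAt.comp x h1).const_mul
          (t ^ k)
        refine h2.congr_deriv ?_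
        ring
    push_cast
    rw [contDiff_succ_iff_deriv]
    refine ⟨fun x => (key x).differentiableAt, by simp, ?_⟩
    rw [show deriv (fun x => ∫ s in (0 : ℝ)..1, s ^ k * f (c + s * (x - c))) = _ from
      funext fun x => (key x).deriv]
    exact ih (k + 1) _ hf'

/-- **Hadamard's lemma**: the divided difference of a smooth function is smooth. -/
theorem contDiff_dslope {f : ℝ → ℝ} (hf : ContDiff ℝ ∞ f) (c : ℝ) : ContDiff ℝ ∞ (dslope f c) := by
  have hf' : ContDiff ℝ ∞ (deriv f) := hf.deriv'
  have h : dslope f c = fun x => ∫ s in (0 : ℝ)..1, s ^ 0 * deriv f (c + s * (x - c)) := by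
    funext x
    rcases eq_or_ne x c with rfl | hx
    · simp
    · have hc := hf'.continuous
      have := intervalIntegral.integral_unitInterval_deriv_eq_sub (f := f) (f' := deriv f)
        (z₀ := c) (z₁ := x - c) (Continuous.continuousOn (by fun_prop))
        (fun t _ => (hf.differentiable (by simp) _).hasDerivAt)
      simp only [smul_eq_mul, add_sub_cancel] at this
      rw [dslope_of_ne _ hx, slope_def_field, ← this]
      simp only [pow_zero, one_mul]
      rw [mul_div_cancel_left₀ _ (sub_ne_zero.2 hx)]
  rw [h, contDiff_infty]
  exact fun n => contDiff_integral_pow_mul_comp c n 0 _ hf'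

/-- Away from `c` this is a quotient of smooth functions. At `c`, multiplying `f` by a bump
supported in `s` reduces to the global case without changing the divided difference near `c`. -/
theorem contDiffOn_dslope {f : ℝ → ℝ} {s : Set ℝ} (hs : IsOpen s) {c : ℝ} (hc : c ∈ s)
    (hf : ContDiffOn ℝ ∞ f s) : ContDiffOn ℝ ∞ (dslope f c) s := by
  intro x hx
  apply ContDiffAt.contDiffWithinAt
  rcases eq_or_ne x c with rfl | hxc
  · obtain ⟨δ, hδ, hδs⟩ := Metric.isOpen_iff.1 hs x hx
    let χ : ContDiffBump x := ⟨δ / 4, δ / 2, by linarith, by linarith⟩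
    have hg : ContDiff ℝ ∞ fun y => χ y * f y := by
      rw [contDiff_iff_contDiffAt]
      intro y
      by_cases hy : y ∈ s
      · exact χ.contDiffAt.mul (hf.contDiffAt (hs.mem_nhds hy))
      · have h1 : (fun y => χ y * f y) =ᶠ[𝓝 y] fun _ => 0 := by
          have : (Metric.closedBall x (δ / 2))ᶜ ∈ 𝓝 y :=
            Metric.isClosed_closedBall.isOpen_compl.mem_nhds fun h =>
              hy (hδs ((Metric.closedBall_subset_ball (by linarith)) h))
          filter_upwards [this] with z hz
          have hz' : ¬ dist z x ≤ δ / 2 := hz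
          rw [χ.zero_of_le_dist (not_le.1 hz').le, zero_mul]
        exact contDiffAt_const.congr_of_eventuallyEq h1
    refine (contDiff_dslope hg x).contDiffAt.congr_of_eventuallyEq ?_
    have h1 : f =ᶠ[𝓝 x] fun y => χ y * f y := by
      filter_upwards [χ.eventuallyEq_one] with y hy
      rw [hy, Pi.one_apply, one_mul]
    filter_upwards [h1] with y hy
    rcases eq_or_ne y x with rfl | hyx
    · rw [dslope_same, dslope_same, h1.deriv_eq]
    · rw [dslope_of_ne _ hyx, dslope_of_ne _ hyx, slope_def_field, slope_def_field]
      congr 1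
      have hx := h1.eq_of_nhds
      linarith
  · refine ContDiffAt.congr_of_eventuallyEq ?_ (dslope_eventuallyEq_slope_of_ne f hxc)
    have : slope f c = fun y => (f y - f c) / (y - c) := funext fun y => slope_def_field f c y
    rw [this]
    exact ((hf.contDiffAt (hs.mem_nhds hx)).sub contDiffAt_const).div
      (contDiffAt_id.sub contDiffAt_const) (sub_ne_zero.2 hxc)

/-- In Leibniz's formula at `c`, only the first derivative of `x - c` is nonzero. -/
theorem iteratedDeriv_succ_sub_mul {D : ℝ → ℝ} {c : ℝ} (hD : ContDiffAt ℝ ∞ D c) (j : ℕ) :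
    iteratedDeriv (j + 1) (fun x => (x - c) * D x) c = (j + 1) * iteratedDeriv j D c := by
  have h0 : ∀ i, iteratedDeriv i (fun x : ℝ => x - c) c = if i = 1 then 1 else 0 := by
    intro i
    rcases i with _ | i
    · simp
    · rw [iteratedDeriv_succ']
      have : deriv (fun x : ℝ => x - c) = fun _ => 1 := by
        funext x
        simp
      rw [this, iteratedDeriv_const]
      simp
  have h1 := iteratedDeriv_mul (n := j + 1) (f := fun x : ℝ => x - c) (g := D) (x := c)
    (by fun_prop) (hD.of_le (by exact_mod_cast le_top))
  have h2 : (fun x => (x - c) * D x) = (fun x : ℝ => x - c) * D := rfl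
  rw [h2, h1, Finset.sum_eq_single 1]
  · rw [h0, if_pos rfl, Nat.choose_one_right, Nat.add_sub_cancel]
    push_cast
    ring
  · intro i _ hi
    rw [h0, if_neg hi, mul_zero, zero_mul]
  · intro h
    exact absurd (Finset.mem_range.2 (by omega)) h

theorem iteratedDeriv_dslope {f : ℝ → ℝ} {s : Set ℝ} (hs : IsOpen s) {c : ℝ} (hc : c ∈ s)
    (hf : ContDiffOn ℝ ∞ f s) (j : ℕ) :
    iteratedDeriv j (dslope f c) c = iteratedDeriv (j + 1) f c / (j + 1) := by
  have hD := (contDiffOn_dslope hs hc hf).contDiffAt (hs.mem_nhds hc)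
  have h1 : f = fun x => f c + (x - c) * dslope f c x := by
    funext x
    have := sub_smul_dslope f c x
    rw [smul_eq_mul] at this
    rw [this]
    ring
  have h2 : iteratedDeriv (j + 1) f c = (j + 1) * iteratedDeriv j (dslope f c) c := by
    rw [← iteratedDeriv_succ_sub_mul hD, h1, iteratedDeriv_const_add (by omega), ← h1]
  rw [h2]
  field_simp

theorem contDiffOn_iterate_dslope {f : ℝ → ℝ} {s : Set ℝ} (hs : IsOpen s) {c : ℝ} (hc : c ∈ s)
    (hf : ContDiffOn ℝ ∞ f s) (k : ℕ) : ContDiffOn ℝ ∞ ((fun f => dslope f c)^[k] f) s := by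
  induction k with
  | zero => exact hf
  | succ k ih =>
    rw [Function.iterate_succ_apply']
    exact contDiffOn_dslope hs hc ih

theorem iteratedDeriv_iterate_dslope {f : ℝ → ℝ} {s : Set ℝ} (hs : IsOpen s) {c : ℝ} (hc : c ∈ s)
    (hf : ContDiffOn ℝ ∞ f s) (k : ℕ) : ∀ j,
    iteratedDeriv j ((fun f => dslope f c)^[k] f) c =
      iteratedDeriv (j + k) f c * (j ! / (j + k)! : ℝ) := by
  induction k with
  | zero =>
    intro j
    have : (j ! : ℝ) ≠ 0 := by positivity
    simp [div_self this]
  | succ k ih =>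
    intro j
    rw [Function.iterate_succ_apply', iteratedDeriv_dslope hs hc
      (contDiffOn_iterate_dslope hs hc hf k), ih, show j + 1 + k = j + (k + 1) by ring,
      Nat.factorial_succ j]
    have : ((j + (k + 1))! : ℝ) ≠ 0 := by positivity
    push_cast
    field_simp

theorem iterate_dslope_same {f : ℝ → ℝ} {s : Set ℝ} (hs : IsOpen s) {c : ℝ} (hc : c ∈ s)
    (hf : ContDiffOn ℝ ∞ f s) (k : ℕ) :
    (fun f => dslope f c)^[k] f c = iteratedDeriv k f c / (k ! : ℝ) := by
  have := iteratedDeriv_iterate_dslope hs hc hf k 0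
  rw [iteratedDeriv_zero] at this
  rw [this]
  simp [div_eq_mul_inv]

/-- Taylor's formula as pure algebra: each remainder `u` is split as `u c + (x - c) * dslope u c x`.
No smoothness enters. -/
theorem eq_sum_add_pow_mul_iterate_dslope (f : ℝ → ℝ) (c : ℝ) (m : ℕ) (x : ℝ) :
    f x = (∑ k ∈ Finset.range m, (fun f => dslope f c)^[k] f c * (x - c) ^ k) +
      (x - c) ^ m * (fun f => dslope f c)^[m] f x := by
  induction m with
  | zero => simp
  | succ m ih =>
    have h := sub_smul_dslope ((fun f => dslope f c)^[m] f) c x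
    rw [smul_eq_mul] at h
    rw [Finset.sum_range_succ, Function.iterate_succ_apply', pow_succ, mul_assoc, h]
    linear_combination ih

/-! ### Periodization and its independence of the pole. -/

/-- The one-sided version of being periodized to order `k`, along a filter. -/
def PeriodizedAlong (F : ℝ → ℝ) (l : Filter ℝ) (k : ℕ) : Prop :=
  (∀ i < k, Tendsto (iteratedDeriv i F) l (𝓝 0)) ∧ IntegrableAtFilter (iteratedDeriv k F) l

theorem periodizedToOrder_iff {F : ℝ → ℝ} {α β : ℝ} {k : ℕ} :
    PeriodizedToOrder F α β k ↔ PeriodizedAlong F (𝓝[>] α) k ∧ PeriodizedAlong F (𝓝[<] β) k := by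
  unfold PeriodizedToOrder PeriodizedAlong
  constructor
  · rintro ⟨h1, h2, h3⟩
    exact ⟨⟨fun i hi => (h1 i hi).1, h2⟩, ⟨fun i hi => (h1 i hi).2, h3⟩⟩
  · rintro ⟨⟨h1, h2⟩, ⟨h3, h4⟩⟩
    exact ⟨fun i hi => ⟨h1 i hi, h3 i hi⟩, h2, h4⟩

theorem integrableAtFilter_sum {ι : Type*} {l : Filter ℝ} (s : Finset ι) (f : ι → ℝ → ℝ)
    (h : ∀ i ∈ s, IntegrableAtFilter (f i) l) :
    IntegrableAtFilter (fun x => ∑ i ∈ s, f i x) l := by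
  classical
  induction s using Finset.induction_on with
  | empty => exact ⟨univ, univ_mem, by simp⟩
  | insert a s ha ih =>
    simp only [Finset.sum_insert ha]
    exact (h a (Finset.mem_insert_self _ _)).add
      (ih fun i hi => h i (Finset.mem_insert_of_mem hi))

theorem continuousOn_iteratedDeriv {f : ℝ → ℝ} {s : Set ℝ} (hs : IsOpen s)
    (hf : ContDiffOn ℝ ∞ f s) (i : ℕ) : ContinuousOn (iteratedDeriv i f) s :=
  (hf.continuousOn_iteratedDerivWithin (by exact_mod_cast le_top) hs.uniqueDiffOn).congr
    fun _ hx => (iteratedDerivWithin_of_isOpen hs hx).symm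

theorem hasDerivAt_iteratedDeriv {f : ℝ → ℝ} {s : Set ℝ} (hs : IsOpen s)
    (hf : ContDiffOn ℝ ∞ f s) (i : ℕ) {x : ℝ} (hx : x ∈ s) :
    HasDerivAt (iteratedDeriv i f) (iteratedDeriv (i + 1) f x) x := by
  rw [iteratedDeriv_succ]
  have h1 := (hf.differentiableOn_iteratedDerivWithin (m := i)
    (by exact_mod_cast WithTop.coe_lt_top _) hs.uniqueDiffOn).congr
    fun _ hx => (iteratedDerivWithin_of_isOpen hs hx).symm
  exact (h1.differentiableAt (hs.mem_nhds hx)).hasDerivAt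

/-- By Leibniz's rule, terms with fewer than `k` derivatives on `Φ` tend to zero, hence are also
integrable along a filter of finite measure. The one remaining term of order `k` is `Φ^(k) M`,
integrable times bounded. -/
theorem PeriodizedAlong.mul {Φ M Ψ : ℝ → ℝ} {l : Filter ℝ} [IsMeasurablyGenerated l]
    (hl : volume.FiniteAtFilter l) {s : Set ℝ} (hs : IsOpen s) (hsl : s ∈ l)
    (hΦ : ContDiffOn ℝ ∞ Φ s) (hM : ContDiffOn ℝ ∞ M s) (hΨ : EqOn Ψ (Φ * M) s) {k : ℕ}
    (h : PeriodizedAlong Φ l k) (hlim : ∀ i ≤ k, ∃ L, Tendsto (iteratedDeriv i M) l (𝓝 L)) :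
    PeriodizedAlong Ψ l k := by
  have hder : ∀ i, EqOn (iteratedDeriv i Ψ) (fun x => ∑ j ∈ Finset.range (i + 1),
      (i.choose j : ℝ) * iteratedDeriv j Φ x * iteratedDeriv (i - j) M x) s := by
    intro i x hx
    rw [hΨ.iteratedDeriv_of_isOpen hs i hx]
    exact iteratedDeriv_mul ((hΦ.contDiffAt (hs.mem_nhds hx)).of_le (by exact_mod_cast le_top))
      ((hM.contDiffAt (hs.mem_nhds hx)).of_le (by exact_mod_cast le_top))
  have hterm : ∀ i ≤ k, ∀ j < k, j ≤ i → Tendsto (fun x =>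
      (i.choose j : ℝ) * iteratedDeriv j Φ x * iteratedDeriv (i - j) M x) l (𝓝 0) := by
    intro i hi j hj _
    obtain ⟨L, hL⟩ := hlim (i - j) (by omega)
    simpa using ((h.1 j hj).const_mul (i.choose j : ℝ)).mul hL
  have hcont : ∀ i j, ContinuousOn (fun x =>
      (i.choose j : ℝ) * iteratedDeriv j Φ x * iteratedDeriv (i - j) M x) s := fun i j =>
    (continuousOn_const.mul (continuousOn_iteratedDeriv hs hΦ j)).mul
      (continuousOn_iteratedDeriv hs hM _)
  constructor
  · intro i hi
    have h1 : Tendsto (fun x => ∑ j ∈ Finset.range (i + 1),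
        (i.choose j : ℝ) * iteratedDeriv j Φ x * iteratedDeriv (i - j) M x) l
        (𝓝 (∑ j ∈ Finset.range (i + 1), 0)) := by
      refine tendsto_finsetSum _ fun j hj => ?_
      have := Finset.mem_range.1 hj
      exact hterm i hi.le j (by omega) (by omega)
    rw [Finset.sum_const_zero] at h1
    refine h1.congr' ?_
    filter_upwards [hsl] with x hx
    exact (hder i hx).symm
  · have h1 : IntegrableAtFilter (fun x => ∑ j ∈ Finset.range (k + 1),
        (k.choose j : ℝ) * iteratedDeriv j Φ x * iteratedDeriv (k - j) M x) l := by
      refine integrableAtFilter_sum _ _ fun j hj => ?_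
      have hj := Finset.mem_range.1 hj
      rcases (Nat.lt_succ_iff.1 hj).lt_or_eq with hjk | rfl
      · refine Measure.FiniteAtFilter.integrableAtFilter_of_tendsto
          ⟨s, hsl, (hcont k j).aestronglyMeasurable hs.measurableSet⟩ hl
          (hterm k le_rfl j hjk hjk.le)
      · obtain ⟨t, htl, ht⟩ := h.2
        obtain ⟨L, hL⟩ := hlim 0 (Nat.zero_le _)
        rw [iteratedDeriv_zero] at hL
        have hb : ∀ᶠ x in l, ‖M x‖ < ‖L‖ + 1 := hL.norm.eventually_lt_const (by linarith)
        obtain ⟨u, hul, hum, hu⟩ := IsMeasurablyGenerated.exists_measurable_subset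
          (inter_mem hsl (inter_mem htl hb))
        refine ⟨u, hul, ?_⟩
        simp only [Nat.choose_self, Nat.cast_one, one_mul, Nat.sub_self, iteratedDeriv_zero]
        refine Integrable.mul_bdd (c := ‖L‖ + 1) (ht.mono_set fun x hx => (hu hx).2.1)
          ((hM.continuousOn.mono fun x hx => (hu hx).1).aestronglyMeasurable hum) ?_
        exact (ae_restrict_iff' hum).2 (ae_of_all _ fun x hx => (hu hx).2.2.le)
    obtain ⟨t, htl, ht⟩ := h1
    obtain ⟨u, hul, hum, hu⟩ := IsMeasurablyGenerated.exists_measurable_subset (inter_mem hsl htl)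
    exact ⟨u, hul, (ht.mono_set fun x hx => (hu hx).2).congr_fun
      (fun x hx => (hder k (hu hx).1).symm) hum⟩

/-- The derivatives within the closed interval are continuous up to the endpoints and agree with the
ordinary ones inside. -/
theorem tendsto_iteratedDeriv_of_contDiffOn_Icc {f : ℝ → ℝ} {u v p : ℝ} (huv : u < v)
    (hp : p ∈ Icc u v) {k : ℕ} (hf : ContDiffOn ℝ k f (Icc u v)) {i : ℕ} (hi : i ≤ k) :
    Tendsto (iteratedDeriv i f) (𝓝[Ioo u v] p) (𝓝 (iteratedDerivWithin i f (Icc u v) p)) := by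
  have h1 := hf.continuousOn_iteratedDerivWithin (m := i) (by exact_mod_cast hi)
    (uniqueDiffOn_Icc huv) p hp
  refine (h1.mono_left (nhdsWithin_mono _ Ioo_subset_Icc_self)).congr' ?_
  filter_upwards [self_mem_nhdsWithin] with x hx
  refine iteratedDerivWithin_eq_iteratedDeriv (uniqueDiffOn_Icc huv) ?_ (Ioo_subset_Icc_self hx)
  exact (hf.contDiffAt (Icc_mem_nhds hx.1 hx.2)).of_le (by exact_mod_cast hi)

theorem contDiffOn_transformed {g ψ : ℝ → ℝ} {t : ℝ} {m : ℕ} {s u : Set ℝ} (hs : IsOpen s)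
    (hg : ContDiffOn ℝ ∞ g u) (hψ : ContDiffOn ℝ ∞ ψ s) (hmap : MapsTo ψ s u)
    (hne : ∀ ξ ∈ s, ψ ξ ≠ t) : ContDiffOn ℝ ∞ (transformed g ψ t m) s := by
  refine ContDiffOn.mul (ContDiffOn.div (hg.comp hψ hmap)
    ((hψ.sub contDiffOn_const).pow m) fun ξ hξ => ?_) (hψ.deriv_of_isOpen hs (by simp))
  exact pow_ne_zero _ (sub_ne_zero.2 (hne ξ hξ))

/-- Changing the singular denominator does not affect periodization near a point where neither
denominator vanishes. -/
theorem PeriodizedAlong.transformed {g g₁ ψ : ℝ → ℝ} {t t₁ u v p : ℝ} {m m₁ k : ℕ} {d : Set ℝ}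
    (huv : u < v) (hp : p ∈ Icc u v) (hg : ContDiffOn ℝ ∞ g d)
    (hψ : ContDiffOn ℝ ∞ ψ (Ioo u v)) (hψk : ContDiffOn ℝ k ψ (Icc u v))
    (hmap : MapsTo ψ (Ioo u v) d) (hgg : ∀ ξ ∈ Ioo u v, g₁ (ψ ξ) = g (ψ ξ))
    (ht : ∀ ξ ∈ Icc u v, ψ ξ ≠ t) (ht₁ : ∀ ξ ∈ Icc u v, ψ ξ ≠ t₁)
    (h : PeriodizedAlong (transformed g ψ t m) (𝓝[Ioo u v] p) k) :
    PeriodizedAlong (transformed g₁ ψ t₁ m₁) (𝓝[Ioo u v] p) k := by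
  -- Needed twice: smoothness on the open interval for Leibniz's rule, and `C^k` on the closed one
  -- for limits at the endpoint.
  have hM : ∀ {n : WithTop ℕ∞} {s : Set ℝ}, s ⊆ Icc u v → ContDiffOn ℝ n ψ s →
      ContDiffOn ℝ n (fun ξ => (ψ ξ - t) ^ m / (ψ ξ - t₁) ^ m₁) s := fun hs hψ =>
    ((hψ.sub contDiffOn_const).pow m).div ((hψ.sub contDiffOn_const).pow m₁) fun ξ hξ =>
      pow_ne_zero _ (sub_ne_zero.2 (ht₁ ξ (hs hξ)))
  have : IsMeasurablyGenerated (𝓝[Ioo u v] p) :=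
    measurableSet_Ioo.nhdsWithin_isMeasurablyGenerated p
  refine h.mul (M := fun ξ => (ψ ξ - t) ^ m / (ψ ξ - t₁) ^ m₁)
    ((volume.finiteAt_nhds p).filter_mono nhdsWithin_le_nhds) isOpen_Ioo
    self_mem_nhdsWithin
    (contDiffOn_transformed isOpen_Ioo hg hψ hmap fun ξ hξ => ht ξ (Ioo_subset_Icc_self hξ))
    (hM Ioo_subset_Icc_self hψ) (fun ξ hξ => ?_)
    fun i hi => ⟨_, tendsto_iteratedDeriv_of_contDiffOn_Icc huv hp (hM Subset.rfl hψk) hi⟩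
  have h1 : (ψ ξ - t) ^ m ≠ 0 := pow_ne_zero _ (sub_ne_zero.2 (ht ξ (Ioo_subset_Icc_self hξ)))
  have h2 : (ψ ξ - t₁) ^ m₁ ≠ 0 := pow_ne_zero _ (sub_ne_zero.2 (ht₁ ξ (Ioo_subset_Icc_self hξ)))
  simp only [PVTSI.transformed, singularIntegrand, Pi.mul_apply, hgg ξ hξ]
  field_simp

theorem strictMonoOn_of_deriv_pos_Ioo {ψ : ℝ → ℝ} {α β : ℝ} (hψc : ContinuousOn ψ (Icc α β))
    (hψ' : ∀ ξ ∈ Ioo α β, 0 < deriv ψ ξ) : StrictMonoOn ψ (Icc α β) :=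
  strictMonoOn_of_deriv_pos (convex_Icc α β) hψc (by rwa [interior_Icc])

theorem mapsTo_Ioo_of_deriv_pos {ψ : ℝ → ℝ} {α β : ℝ} (hαβ : α < β)
    (hψc : ContinuousOn ψ (Icc α β)) (hψ' : ∀ ξ ∈ Ioo α β, 0 < deriv ψ ξ) :
    MapsTo ψ (Ioo α β) (Ioo (ψ α) (ψ β)) := fun _ hξ =>
  have h := strictMonoOn_of_deriv_pos_Ioo hψc hψ'
  ⟨h (left_mem_Icc.2 hαβ.le) (Ioo_subset_Icc_self hξ) hξ.1,
    h (Ioo_subset_Icc_self hξ) (right_mem_Icc.2 hαβ.le) hξ.2⟩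

/-- The order of periodization depends only on `ψ` and on `g` near the endpoints. -/
theorem periodizedToOrder_transformed_of_eventuallyEq {a b t t₁ α β : ℝ} {g g₁ ψ : ℝ → ℝ}
    {m m₁ k : ℕ} (hαβ : α < β) (ht : t ∈ Ioo a b) (ht₁ : t₁ ∈ Ioo a b)
    (hg : ContDiffOn ℝ ∞ g (Ioo a b))
    (hψc : ContinuousOn ψ (Icc α β)) (hψs : ContDiffOn ℝ ∞ ψ (Ioo α β))
    (hψα : ψ α = a) (hψβ : ψ β = b) (hψ' : ∀ ξ ∈ Ioo α β, 0 < deriv ψ ξ)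
    (ha : g₁ =ᶠ[𝓝[>] a] g) (hb : g₁ =ᶠ[𝓝[<] b] g) (hψk : ContDiffOn ℝ k ψ (Icc α β))
    (h : PeriodizedToOrder (transformed g ψ t m) α β k) :
    PeriodizedToOrder (transformed g₁ ψ t₁ m₁) α β k := by
  have hmaps := mapsTo_Ioo_of_deriv_pos hαβ hψc hψ'
  rw [hψα, hψβ] at hmaps
  rw [periodizedToOrder_iff] at h ⊢
  constructor
  · have hlim : Tendsto ψ (𝓝[>] α) (𝓝[>] a) := by
      rw [← nhdsWithin_Ioo_eq_nhdsGT hαβ]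
      refine tendsto_nhdsWithin_iff.2 ⟨?_, ?_⟩
      · rw [← hψα]
        exact (hψc α (left_mem_Icc.2 hαβ.le)).mono_left (nhdsWithin_mono _ Ioo_subset_Icc_self)
      · filter_upwards [self_mem_nhdsWithin] with x hx using (hmaps hx).1
    have hev : ∀ᶠ ξ in 𝓝[>] α, g₁ (ψ ξ) = g (ψ ξ) ∧ ψ ξ < min t t₁ := by
      refine (hlim.eventually ha).and (hlim.eventually (nhdsWithin_le_nhds (Iio_mem_nhds ?_)))
      exact lt_min ht.1 ht₁.1
    obtain ⟨c, hc, hcs⟩ := (mem_nhdsGT_iff_exists_mem_Ioc_Ioo_subset hαβ).1 hev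
    -- Shrinking `c` to `c'` keeps both denominators nonzero on a closed interval, including `α`,
    -- where `ψ α = a` lies below both poles.
    obtain ⟨c', hc'1, hc'2⟩ := exists_between hc.1
    have hsub : Icc α c' ⊆ Icc α β := Icc_subset_Icc_right (by linarith [hc.2])
    have hsub' : Ioo α c' ⊆ Ioo α β := Ioo_subset_Ioo_right (by linarith [hc.2])
    have hlt : ∀ ξ ∈ Icc α c', ψ ξ < min t t₁ := by
      intro ξ hξ
      rcases hξ.1.eq_or_lt with rfl | h1
      · rw [hψα]
        exact lt_min ht.1 ht₁.1
      · exact (hcs ⟨h1, by linarith [hξ.2]⟩).2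
    have h1 := h.1
    rw [← nhdsWithin_Ioo_eq_nhdsGT hc'1] at h1 ⊢
    exact h1.transformed hc'1 (left_mem_Icc.2 hc'1.le) hg (hψs.mono hsub') (hψk.mono hsub)
      (hmaps.mono_left hsub') (fun ξ hξ => (hcs ⟨hξ.1, hξ.2.trans hc'2⟩).1)
      (fun ξ hξ => ((hlt ξ hξ).trans_le (min_le_left _ _)).ne)
      (fun ξ hξ => ((hlt ξ hξ).trans_le (min_le_right _ _)).ne)
  · have hlim : Tendsto ψ (𝓝[<] β) (𝓝[<] b) := by
      rw [← nhdsWithin_Ioo_eq_nhdsLT hαβ]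
      refine tendsto_nhdsWithin_iff.2 ⟨?_, ?_⟩
      · rw [← hψβ]
        exact (hψc β (right_mem_Icc.2 hαβ.le)).mono_left (nhdsWithin_mono _ Ioo_subset_Icc_self)
      · filter_upwards [self_mem_nhdsWithin] with x hx using (hmaps hx).2
    have hev : ∀ᶠ ξ in 𝓝[<] β, g₁ (ψ ξ) = g (ψ ξ) ∧ max t t₁ < ψ ξ := by
      refine (hlim.eventually hb).and (hlim.eventually (nhdsWithin_le_nhds (Ioi_mem_nhds ?_)))
      exact max_lt ht.2 ht₁.2
    obtain ⟨c, hc, hcs⟩ := (mem_nhdsLT_iff_exists_mem_Ico_Ioo_subset hαβ).1 hev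
    obtain ⟨c', hc'1, hc'2⟩ := exists_between hc.2
    have hsub : Icc c' β ⊆ Icc α β := Icc_subset_Icc_left (by linarith [hc.1])
    have hsub' : Ioo c' β ⊆ Ioo α β := Ioo_subset_Ioo_left (by linarith [hc.1])
    have hlt : ∀ ξ ∈ Icc c' β, max t t₁ < ψ ξ := by
      intro ξ hξ
      rcases hξ.2.eq_or_lt with rfl | h1
      · rw [hψβ]
        exact max_lt ht.2 ht₁.2
      · exact (hcs ⟨by linarith [hξ.1], h1⟩).2
    have h1 := h.2
    rw [← nhdsWithin_Ioo_eq_nhdsLT hc'2] at h1 ⊢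
    exact h1.transformed hc'2 (right_mem_Icc.2 hc'2.le) hg (hψs.mono hsub') (hψk.mono hsub)
      (hmaps.mono_left hsub') (fun ξ hξ => (hcs ⟨hc'1.trans hξ.1, hξ.2⟩).1)
      (fun ξ hξ => ((le_max_left _ _).trans_lt (hlt ξ hξ)).ne')
      (fun ξ hξ => ((le_max_right _ _).trans_lt (hlt ξ hξ)).ne')

/-! ### Periodic extension and the offset trapezoidal rule. -/

theorem periodicExtension_of_mem_Ioo (f : ℝ → ℝ) {α β ξ : ℝ} (h : ξ ∈ Ioo α β) :
    periodicExtension f α β ξ = f ξ := by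
  have hT : 0 < β - α := by linarith [h.1, h.2]
  have h0 : ⌊(ξ - α) / (β - α)⌋ = 0 := by
    rw [Int.floor_eq_zero_iff]
    exact ⟨div_nonneg (by linarith [h.1]) hT.le, (div_lt_one hT).2 (by linarith [h.2])⟩
  simp [periodicExtension, h0, h.1.ne']

theorem periodicExtension_left (f : ℝ → ℝ) (α β : ℝ) : periodicExtension f α β α = 0 := by
  simp [periodicExtension]

theorem periodic_periodicExtension (f : ℝ → ℝ) {α β : ℝ} (hαβ : α < β) :
    Function.Periodic (periodicExtension f α β) (β - α) := by
  intro ξ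
  have hT : β - α ≠ 0 := (sub_pos.2 hαβ).ne'
  have h1 : (ξ + (β - α) - α) / (β - α) = (ξ - α) / (β - α) + 1 := by
    field_simp
    ring
  simp only [periodicExtension, h1, Int.floor_add_one]
  have h2 : ξ + (β - α) - ((⌊(ξ - α) / (β - α)⌋ + 1 : ℤ) : ℝ) * (β - α) =
      ξ - (⌊(ξ - α) / (β - α)⌋ : ℝ) * (β - α) := by
    push_cast
    ring
  rw [h2]

theorem periodicExtension_right (f : ℝ → ℝ) {α β : ℝ} (hαβ : α < β) :
    periodicExtension f α β β = 0 := by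
  have := periodic_periodicExtension f hαβ α
  rwa [add_sub_cancel, periodicExtension_left] at this

theorem periodicExtension_of_mem_Ioo_add (f : ℝ → ℝ) {α β ξ : ℝ} (hαβ : α < β)
    (h : ξ ∈ Ioo β (β + (β - α))) : periodicExtension f α β ξ = f (ξ - (β - α)) := by
  rw [← (periodic_periodicExtension f hαβ).sub_eq,
    periodicExtension_of_mem_Ioo f ⟨by linarith [h.1], by linarith [h.2]⟩]

/-- The window contains the closed period starting at any interior `τ`. Its only junction is `β`,
where both one-sided limits match the assigned value `0`. -/
theorem continuousAt_periodicExtension {f : ℝ → ℝ} {α β ξ : ℝ}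
    (hf : ContinuousOn f (Ioo α β)) (hα : Tendsto f (𝓝[>] α) (𝓝 0))
    (hβ : Tendsto f (𝓝[<] β) (𝓝 0)) (hξ : ξ ∈ Ioo α (β + (β - α))) :
    ContinuousAt (periodicExtension f α β) ξ := by
  have hαβ : α < β := by linarith [hξ.1.trans hξ.2]
  rcases lt_trichotomy ξ β with h | rfl | h
  · refine (hf.continuousAt (Ioo_mem_nhds hξ.1 h)).congr ?_
    filter_upwards [Ioo_mem_nhds hξ.1 h] with x hx
    rw [periodicExtension_of_mem_Ioo f hx]
  · rw [continuousAt_iff_continuous_left'_right', ContinuousWithinAt, ContinuousWithinAt,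
      periodicExtension_right f hαβ]
    constructor
    · refine hβ.congr' ?_
      filter_upwards [Ioo_mem_nhdsLT hαβ] with x hx
      rw [periodicExtension_of_mem_Ioo f hx]
    · have h1 : Tendsto (fun x => x - (ξ - α)) (𝓝[>] ξ) (𝓝[>] α) := by
        refine tendsto_nhdsWithin_iff.2 ⟨?_, ?_⟩
        · have : Tendsto (fun x => x - (ξ - α)) (𝓝 ξ) (𝓝 (ξ - (ξ - α))) :=
            (continuous_id.sub continuous_const).tendsto ξ
          rw [sub_sub_cancel] at this
          exact this.mono_left nhdsWithin_le_nhds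
        · filter_upwards [self_mem_nhdsWithin] with x hx
          have : ξ < x := hx
          simp only [mem_Ioi]
          linarith
      refine (hα.comp h1).congr' ?_
      filter_upwards [Ioo_mem_nhdsGT hξ.2] with x hx
      rw [periodicExtension_of_mem_Ioo_add f hαβ hx]
      rfl
  · have h1 : ContinuousAt (fun x => f (x - (β - α))) ξ := by
      refine ContinuousAt.comp (f := fun x => x - (β - α)) (g := f) ?_ (by fun_prop)
      exact hf.continuousAt (Ioo_mem_nhds (by linarith) (by linarith [hξ.2]))
    refine h1.congr ?_
    filter_upwards [Ioo_mem_nhds h hξ.2] with x hx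
    rw [periodicExtension_of_mem_Ioo_add f hαβ hx]

theorem hasDerivAt_periodicExtension {f f' : ℝ → ℝ} {α β ξ : ℝ}
    (hf : ∀ x ∈ Ioo α β, HasDerivAt f (f' x) x) (hξ : ξ ∈ Ioo α (β + (β - α))) (hne : ξ ≠ β) :
    HasDerivAt (periodicExtension f α β) (periodicExtension f' α β ξ) ξ := by
  have hαβ : α < β := by linarith [hξ.1.trans hξ.2]
  rcases hne.lt_or_gt with h | h
  · rw [periodicExtension_of_mem_Ioo f' ⟨hξ.1, h⟩]
    refine (hf ξ ⟨hξ.1, h⟩).congr_of_eventuallyEq ?_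
    filter_upwards [Ioo_mem_nhds hξ.1 h] with x hx
    rw [periodicExtension_of_mem_Ioo f hx]
  · rw [periodicExtension_of_mem_Ioo_add f' hαβ ⟨h, hξ.2⟩]
    have h1 := (hf (ξ - (β - α)) ⟨by linarith, by linarith [hξ.2]⟩).comp_sub_const ξ (β - α)
    refine h1.congr_of_eventuallyEq ?_
    filter_upwards [Ioo_mem_nhds h hξ.2] with x hx
    rw [periodicExtension_of_mem_Ioo_add f hαβ hx]

theorem ae_eq_periodicExtension (f : ℝ → ℝ) {α β : ℝ} :
    periodicExtension f α β =ᵐ[volume.restrict (Ioc α β)] f := by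
  rw [← Measure.restrict_congr_set Ioo_ae_eq_Ioc]
  refine (ae_restrict_iff' measurableSet_Ioo).2 (ae_of_all _ fun x hx => ?_)
  exact periodicExtension_of_mem_Ioo f hx

theorem integral_periodicExtension (f : ℝ → ℝ) {α β : ℝ} (hαβ : α < β) (τ : ℝ) :
    ∫ x in (0 : ℝ)..(β - α), periodicExtension f α β (τ + x) = ∫ x in α..β, f x := by
  rw [intervalIntegral.integral_comp_add_left (fun x => periodicExtension f α β x), add_zero,
    (periodic_periodicExtension f hαβ).intervalIntegral_add_eq τ α, add_sub_cancel,
    intervalIntegral.integral_of_le hαβ.le, intervalIntegral.integral_of_le hαβ.le]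
  exact integral_congr_ae (ae_eq_periodicExtension f)

theorem intervalIntegrable_periodicExtension {f : ℝ → ℝ} {α β : ℝ} (hαβ : α < β)
    (hf : IntervalIntegrable f volume α β) (τ : ℝ) :
    IntervalIntegrable (fun x => periodicExtension f α β (τ + x)) volume 0 (β - α) := by
  have h1 : IntervalIntegrable (periodicExtension f α β) volume α (α + (β - α)) := by
    rw [add_sub_cancel, intervalIntegrable_iff_integrableOn_Ioc_of_le hαβ.le]
    rw [intervalIntegrable_iff_integrableOn_Ioc_of_le hαβ.le] at hf
    exact Integrable.congr hf (ae_eq_periodicExtension f).symm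
  have h2 := (periodic_periodicExtension f hαβ).intervalIntegrable (sub_pos.2 hαβ).ne' h1
    τ (τ + (β - α))
  simpa using h2.comp_add_left τ

theorem intervalIntegrable_of_integrableAtFilter {f : ℝ → ℝ} {α β : ℝ} (hαβ : α < β)
    (hf : ContinuousOn f (Ioo α β)) (hα : IntegrableAtFilter f (𝓝[>] α))
    (hβ : IntegrableAtFilter f (𝓝[<] β)) : IntervalIntegrable f volume α β := by
  obtain ⟨s, hs, hsi⟩ := hα
  obtain ⟨s', hs', hsi'⟩ := hβ
  obtain ⟨c, hc, hcs⟩ := (mem_nhdsGT_iff_exists_mem_Ioc_Ioo_subset hαβ).1 hs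
  obtain ⟨d, hd, hds⟩ := (mem_nhdsLT_iff_exists_mem_Ico_Ioo_subset hαβ).1 hs'
  obtain ⟨c', hc'1, hc'2⟩ := exists_between hc.1
  obtain ⟨d', hd'1, hd'2⟩ := exists_between hd.2
  rw [intervalIntegrable_iff_integrableOn_Ioo_of_le hαβ.le]
  have h1 : IntegrableOn f (Icc c' d') :=
    (hf.mono fun x hx => ⟨hc'1.trans_le hx.1, hx.2.trans_lt hd'2⟩).integrableOn_Icc
  refine (((hsi.mono_set hcs).union h1).union (hsi'.mono_set hds)).mono_set fun x hx => ?_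
  by_cases h2 : x < c
  · exact Or.inl (Or.inl ⟨hx.1, h2⟩)
  · by_cases h3 : d < x
    · exact Or.inr ⟨h3, hx.2⟩
    · exact Or.inl (Or.inr ⟨by linarith [not_lt.1 h2], by linarith [not_lt.1 h3]⟩)

theorem intervalIntegrable_of_tendsto_zero {f : ℝ → ℝ} {α β : ℝ} (hαβ : α < β)
    (hf : ContinuousOn f (Ioo α β)) (hα : Tendsto f (𝓝[>] α) (𝓝 0))
    (hβ : Tendsto f (𝓝[<] β) (𝓝 0)) : IntervalIntegrable f volume α β := by
  refine intervalIntegrable_of_integrableAtFilter hαβ hf ?_ ?_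
  · exact Measure.FiniteAtFilter.integrableAtFilter_of_tendsto
      ⟨Ioo α β, Ioo_mem_nhdsGT hαβ, hf.aestronglyMeasurable measurableSet_Ioo⟩
      ((volume.finiteAt_nhds α).filter_mono nhdsWithin_le_nhds) hα
  · exact Measure.FiniteAtFilter.integrableAtFilter_of_tendsto
      ⟨Ioo α β, Ioo_mem_nhdsLT hαβ, hf.aestronglyMeasurable measurableSet_Ioo⟩
      ((volume.finiteAt_nhds β).filter_mono nhdsWithin_le_nhds) hβ

/-- The offset trapezoidal rule for a smooth function periodized to order `q` has error
`O(h^q)`. -/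
theorem exists_bound_trapezoid_periodicExtension {W : ℝ → ℝ} {α β τ : ℝ} {q : ℕ} (hq : 1 ≤ q)
    (hτ : τ ∈ Ioo α β) (hW : ContDiffOn ℝ ∞ W (Ioo α β)) (hp : PeriodizedToOrder W α β q) :
    ∃ K : ℝ, ∀ n : ℕ, 1 ≤ n →
      |(β - α) / n * (∑ j ∈ Finset.range n,
          periodicExtension W α β (τ + j * ((β - α) / n))) - ∫ x in α..β, W x| ≤
        K * ((β - α) / n) ^ q := by
  have hαβ : α < β := hτ.1.trans hτ.2
  obtain ⟨C, hC0, hC⟩ := exists_eulerMaclaurin_bound q hq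
  set U : ℕ → ℝ → ℝ := fun i x => periodicExtension (iteratedDeriv i W) α β (τ + x) with hU
  refine ⟨C * ∫ x in (0 : ℝ)..(β - α), |U q x|, fun n hn => ?_⟩
  have hn0 : (0 : ℝ) < n := by exact_mod_cast hn
  have hnh : (n : ℝ) * ((β - α) / n) = β - α := by field_simp
  have hmem : ∀ x ∈ Icc 0 (β - α), τ + x ∈ Ioo α (β + (β - α)) := fun x hx =>
    ⟨by linarith [hx.1, hτ.1], by linarith [hx.2, hτ.2]⟩
  have hqi : IntervalIntegrable (iteratedDeriv q W) volume α β :=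
    intervalIntegrable_of_integrableAtFilter hαβ (continuousOn_iteratedDeriv isOpen_Ioo hW q)
      hp.2.1 hp.2.2
  -- The exceptional set is the junction `β` seen from `τ`, the only point of the period where
  -- differentiability may fail.
  have h1 := hC U n ((β - α) / n) {β - τ} (div_pos (sub_pos.2 hαβ) hn0)
    (countable_singleton _) (fun i hi => ?_) (fun i hi x hx => ?_) ?_
  · have h2 : ∀ i, U i (β - α) = U i 0 := fun i => by
      simp only [hU, add_zero]
      exact periodic_periodicExtension _ hαβ τ
    simp only [hnh, h2, sub_self, abs_zero, mul_zero, Finset.sum_const_zero, zero_add] at h1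
    have h3 : ∫ x in (0 : ℝ)..(β - α), U 0 x = ∫ x in α..β, W x := by
      simp only [hU, iteratedDeriv_zero]
      exact integral_periodicExtension W hαβ τ
    rw [h3] at h1
    simp only [hU, iteratedDeriv_zero] at h1 ⊢
    refine h1.trans (le_of_eq (by ring))
  · rw [hnh]
    intro x hx
    refine ContinuousAt.continuousWithinAt ?_
    have h1 : ContinuousAt (fun y : ℝ => τ + y) x := by fun_prop
    refine ContinuousAt.comp (g := periodicExtension (iteratedDeriv i W) α β) ?_ h1
    exact continuousAt_periodicExtension (continuousOn_iteratedDeriv isOpen_Ioo hW i)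
      (hp.1 i hi).1 (hp.1 i hi).2 (hmem x hx)
  · rw [hnh] at hx
    refine HasDerivAt.comp_const_add τ x ?_
    refine hasDerivAt_periodicExtension
      (fun y hy => hasDerivAt_iteratedDeriv isOpen_Ioo hW i hy)
      (hmem x (Ioo_subset_Icc_self hx.1)) fun h => hx.2 ?_
    rw [mem_singleton_iff]
    linarith
  · rw [hnh]
    exact intervalIntegrable_periodicExtension hαβ hqi τ

/-! ### Splitting off the polar part; punctured sums. -/

theorem PeriodizedAlong.congr {F F' : ℝ → ℝ} {l : Filter ℝ} [IsMeasurablyGenerated l] {k : ℕ}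
    {s : Set ℝ} (hs : IsOpen s) (hsl : s ∈ l) (h : PeriodizedAlong F l k) (hFF : EqOn F F' s) :
    PeriodizedAlong F' l k := by
  refine ⟨fun i hi => (h.1 i hi).congr' ?_, ?_⟩
  · filter_upwards [hsl] with x hx
    exact hFF.iteratedDeriv_of_isOpen hs i hx
  · obtain ⟨t, htl, ht⟩ := h.2
    obtain ⟨u, hul, hum, hu⟩ := IsMeasurablyGenerated.exists_measurable_subset (inter_mem hsl htl)
    exact ⟨u, hul, (ht.mono_set fun x hx => (hu hx).2).congr_fun
      (fun x hx => hFF.iteratedDeriv_of_isOpen hs k (hu hx).1) hum⟩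

/-- The Taylor coefficients of `G` at `τ`, as iterated divided differences. -/
noncomputable def taylorCoeff (G : ℝ → ℝ) (τ : ℝ) (k : ℕ) : ℝ := (fun f => dslope f τ)^[k] G τ

/-- The cut-off polar part at `0`, with coefficients `c`, of a function with a pole of
order `m`. -/
noncomputable def polarPart (χ : ContDiffBump (0 : ℝ)) (c : ℕ → ℝ) (m : ℕ) (y : ℝ) : ℝ :=
  ∑ k ∈ Finset.range m, c k * (χ y * y ^ (-((m - k : ℕ) : ℤ)))

/-- The function `G(ξ) / (ξ - τ)^m` minus its cut-off polar part at `τ`, extended smoothly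
through `τ`. -/
noncomputable def regularized (χ : ContDiffBump (0 : ℝ)) (G : ℝ → ℝ) (τ : ℝ) (m : ℕ) (ξ : ℝ) : ℝ :=
  (fun f => dslope f τ)^[m] G ξ +
    ∑ k ∈ Finset.range m, taylorCoeff G τ k * cutoffPow χ (m - k) (ξ - τ)

section

variable (χ : ContDiffBump (0 : ℝ))

theorem polarPart_eq_zero (c : ℕ → ℝ) (m : ℕ) {y : ℝ} (hy : χ.rOut ≤ |y|) :
    polarPart χ c m y = 0 := by
  simp [polarPart, bump_eq_zero χ hy]

/-- Each polar Taylor term is split by `1 = χ + (1 - χ)`: the `χ` share is the polar part, the rest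
is smooth. -/
theorem regularized_add_polarPart (G : ℝ → ℝ) {τ ξ : ℝ} (m : ℕ) (hξ : ξ ≠ τ) :
    regularized χ G τ m ξ + polarPart χ (taylorCoeff G τ) m (ξ - τ) = G ξ / (ξ - τ) ^ m := by
  have hy : ξ - τ ≠ 0 := sub_ne_zero.2 hξ
  rw [eq_sum_add_pow_mul_iterate_dslope G τ m ξ, add_div, mul_div_cancel_left₀ _ (pow_ne_zero _ hy),
    regularized, polarPart, add_assoc, ← Finset.sum_add_distrib, Finset.sum_div, add_comm]
  congr 1
  refine Finset.sum_congr rfl fun k hk => ?_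
  have hk := Finset.mem_range.1 hk
  have h1 : (ξ - τ) ^ m = (ξ - τ) ^ (m - k) * (ξ - τ) ^ k := by rw [← pow_add]; congr 1; omega
  rw [cutoffPow, zpow_neg, zpow_natCast, h1, taylorCoeff]
  field_simp
  ring

theorem contDiffOn_regularized {G : ℝ → ℝ} {s : Set ℝ} (hs : IsOpen s) {τ : ℝ} (hτ : τ ∈ s)
    (hG : ContDiffOn ℝ ∞ G s) (m : ℕ) : ContDiffOn ℝ ∞ (regularized χ G τ m) s := by
  refine (contDiffOn_iterate_dslope hs hτ hG m).add (ContDiffOn.sum fun k _ => ?_)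
  exact contDiffOn_const.mul (((contDiff_cutoffPow χ _).comp
    (contDiff_id.sub contDiff_const)).contDiffOn)

/-- This is the value at the omitted node, the source of the `ζ(0)` term. -/
theorem regularized_self (G : ℝ → ℝ) (τ : ℝ) (m : ℕ) :
    regularized χ G τ m τ = taylorCoeff G τ m := by
  have h : ∀ s, cutoffPow χ s 0 = 0 := fun s =>
    cutoffPow_of_abs_le χ s (by simpa using χ.rIn_pos.le)
  simp [regularized, h, taylorCoeff]

theorem periodizedToOrder_regularized {F G : ℝ → ℝ} {α β τ : ℝ} {m q : ℕ}
    (hα : α + χ.rOut < τ) (hβ : τ + χ.rOut < β)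
    (hFG : ∀ ξ ∈ Ioo α β, ξ ≠ τ → F ξ = G ξ / (ξ - τ) ^ m)
    (hF : PeriodizedToOrder F α β q) : PeriodizedToOrder (regularized χ G τ m) α β q := by
  have h0 := χ.rOut_pos
  have key : ∀ ξ ∈ Ioo α β, χ.rOut ≤ |ξ - τ| → F ξ = regularized χ G τ m ξ := by
    intro ξ hξ h
    have hne : ξ ≠ τ := by
      rintro rfl
      rw [sub_self, abs_zero] at h
      linarith
    rw [hFG ξ hξ hne, ← regularized_add_polarPart χ G m hne, polarPart_eq_zero χ _ _ h, add_zero]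
  rw [periodizedToOrder_iff] at hF ⊢
  refine ⟨hF.1.congr (s := Ioo α (τ - χ.rOut)) isOpen_Ioo (Ioo_mem_nhdsGT (by linarith))
    fun ξ hξ => key ξ ⟨hξ.1, by linarith [hξ.2]⟩ (le_abs.2 (Or.inr (by linarith [hξ.2]))),
    hF.2.congr (s := Ioo (τ + χ.rOut) β) isOpen_Ioo (Ioo_mem_nhdsLT (by linarith))
    fun ξ hξ => key ξ ⟨by linarith [hξ.1], hξ.2⟩ (le_abs.2 (Or.inl (by linarith [hξ.1])))⟩

theorem polarPart_neg (c : ℕ → ℝ) (m : ℕ) (y : ℝ) :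
    polarPart χ c m (-y) = polarPart χ (fun k => c k * (-1) ^ (m - k)) m y := by
  refine Finset.sum_congr rfl fun k _ => ?_
  rw [χ.neg, zpow_neg, zpow_neg, zpow_natCast, zpow_natCast, neg_pow, mul_inv,
    ← inv_pow (-1 : ℝ), inv_neg_one]
  ring

/-- The factor `1 + (-1)^(m - k)` kills the odd orders, in particular order one, the only one that
could bring in logarithms. -/
theorem polarPart_add_polarPart_neg (c : ℕ → ℝ) (m : ℕ) (y : ℝ) :
    polarPart χ c m y + polarPart χ c m (-y) = ∑ k ∈ Finset.range m,
      c k * (1 + (-1) ^ (m - k)) * (χ y * y ^ (-((m - k : ℕ) : ℤ))) := by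
  rw [polarPart_neg, polarPart, polarPart, ← Finset.sum_add_distrib]
  exact Finset.sum_congr rfl fun k _ => by ring

/-- Over a period starting at `τ` the pole shows up at both ends, `x = 0` and `x = β - α`. The bump
is narrow enough that the two polar parts have disjoint supports and vanish at the junction. -/
theorem periodicExtension_eq_add {F G : ℝ → ℝ} {α β τ : ℝ} {m : ℕ} (hτ : τ ∈ Ioo α β)
    (hα : α + χ.rOut < τ) (hβ : τ + χ.rOut < β)
    (hFG : ∀ ξ ∈ Ioo α β, ξ ≠ τ → F ξ = G ξ / (ξ - τ) ^ m) {x : ℝ} (hx : x ∈ Ioo 0 (β - α)) :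
    periodicExtension F α β (τ + x) = periodicExtension (regularized χ G τ m) α β (τ + x) +
      (polarPart χ (taylorCoeff G τ) m x +
        polarPart χ (taylorCoeff G τ) m (x - (β - α))) := by
  have hαβ : α < β := hτ.1.trans hτ.2
  have hr : τ + x ≤ β → polarPart χ (taylorCoeff G τ) m (x - (β - α)) = 0 := fun h =>
    polarPart_eq_zero χ _ _ (le_abs.2 (Or.inr (by linarith)))
  have hl : β ≤ τ + x → polarPart χ (taylorCoeff G τ) m x = 0 := fun h =>
    polarPart_eq_zero χ _ _ (le_abs.2 (Or.inl (by linarith)))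
  rcases lt_trichotomy (τ + x) β with h | h | h
  · have hm : τ + x ∈ Ioo α β := ⟨by linarith [hτ.1, hx.1], h⟩
    have hne : τ + x ≠ τ := by
      intro h'
      linarith [hx.1]
    rw [hr h.le, periodicExtension_of_mem_Ioo _ hm, periodicExtension_of_mem_Ioo _ hm,
      hFG _ hm hne, ← regularized_add_polarPart χ G m hne, add_sub_cancel_left, add_zero]
  · rw [hr h.le, hl h.ge, h, periodicExtension_right _ hαβ, periodicExtension_right _ hαβ]
    simp
  · have hm : τ + x ∈ Ioo β (β + (β - α)) := ⟨h, by linarith [hτ.2, hx.2]⟩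
    have hm' : τ + x - (β - α) ∈ Ioo α β := ⟨by linarith, by linarith [hm.2]⟩
    have hne : τ + x - (β - α) ≠ τ := by
      intro h'
      linarith [hx.2]
    rw [hl h.le, periodicExtension_of_mem_Ioo_add _ hαβ hm,
      periodicExtension_of_mem_Ioo_add _ hαβ hm, hFG _ hm' hne,
      ← regularized_add_polarPart χ G m hne, zero_add]
    congr 2
    ring

theorem sum_polarPart_nodes (c : ℕ → ℝ) (m : ℕ) {T : ℝ} {n : ℕ} (hn : 1 ≤ n) :
    ∑ j ∈ Finset.Ico 1 n, (polarPart χ c m (j * (T / n)) + polarPart χ c m (j * (T / n) - T)) =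
      ∑ k ∈ Finset.range m, c k * (1 + (-1) ^ (m - k)) *
        ∑ j ∈ Finset.Ico 1 n, χ (j * (T / n)) * (j * (T / n)) ^ (-((m - k : ℕ) : ℤ)) := by
  have hn0 : (n : ℝ) ≠ 0 := by positivity
  have h1 : ∑ j ∈ Finset.Ico 1 n, polarPart χ c m (j * (T / n) - T) =
      ∑ j ∈ Finset.Ico 1 n, polarPart χ c m (-(j * (T / n))) := by
    -- The reflection `j ↦ n - j` carries the node `j * (T / n) - T` to `-(j * (T / n))`.
    have := Finset.sum_Ico_reflect (fun j : ℕ => polarPart χ c m (-(j * (T / n)))) 1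
      (show n ≤ n + 1 by omega)
    rw [show n + 1 - n = 1 by omega, show n + 1 - 1 = n by omega] at this
    rw [← this]
    refine Finset.sum_congr rfl fun j hj => ?_
    have hj := Finset.mem_Ico.1 hj
    congr 1
    rw [Nat.cast_sub hj.2.le]
    field_simp
    ring
  rw [Finset.sum_add_distrib, h1, ← Finset.sum_add_distrib]
  simp only [polarPart_add_polarPart_neg, Finset.mul_sum]
  exact Finset.sum_comm

/-- Offset trapezoidal sums over the nodes other than the pole. -/
theorem exists_bound_punctured_trapezoid {F G : ℝ → ℝ} {α β τ : ℝ} {m q : ℕ} (hq : 1 ≤ q)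
    (hτ : τ ∈ Ioo α β) (hα : α + χ.rOut < τ) (hβ : τ + χ.rOut < β)
    (hG : ContDiffOn ℝ ∞ G (Ioo α β))
    (hFG : ∀ ξ ∈ Ioo α β, ξ ≠ τ → F ξ = G ξ / (ξ - τ) ^ m)
    (hF : PeriodizedToOrder F α β q) :
    ∃ K : ℝ, ∀ n : ℕ, 1 ≤ n →
      |(β - α) / n * (∑ j ∈ Finset.Ico 1 n, periodicExtension F α β (τ + j * ((β - α) / n))) -
        (((∫ x in α..β, regularized χ G τ m x) - ∑ k ∈ Finset.range m,
            taylorCoeff G τ k * (1 + (-1) ^ (m - k)) * cutoffConst χ (m - k)) +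
          ((∑ k ∈ Finset.range m, taylorCoeff G τ k * (1 + (-1) ^ (m - k)) *
            ((riemannZeta (m - k : ℕ)).re * ((β - α) / n) ^ (-((m - k : ℕ) : ℤ) + 1))) -
          taylorCoeff G τ m * ((β - α) / n)))| ≤ K * ((β - α) / n) ^ q := by
  have hαβ : α < β := hτ.1.trans hτ.2
  obtain ⟨K₀, hK₀⟩ := exists_bound_trapezoid_periodicExtension hq hτ
    (contDiffOn_regularized χ isOpen_Ioo hτ hG m)
    (periodizedToOrder_regularized χ hα hβ hFG hF)
  have hterm : ∀ k ∈ Finset.range m, ∃ K : ℝ, ∀ n : ℕ, 1 ≤ n →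
      |taylorCoeff G τ k * (1 + (-1) ^ (m - k)) * ((β - α) / n *
          (∑ j ∈ Finset.Ico 1 n,
            χ (j * ((β - α) / n)) * (j * ((β - α) / n)) ^ (-((m - k : ℕ) : ℤ))) -
        ((riemannZeta (m - k : ℕ)).re * ((β - α) / n) ^ (-((m - k : ℕ) : ℤ) + 1) -
          cutoffConst χ (m - k)))| ≤ K * ((β - α) / n) ^ q := by
    intro k hk
    have hk := Finset.mem_range.1 hk
    by_cases h2 : 2 ≤ m - k
    · obtain ⟨K, hK⟩ := exists_bound_sum_bump_mul_zpow χ h2 hq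
      refine ⟨|taylorCoeff G τ k * (1 + (-1) ^ (m - k))| * K, fun n hn => ?_⟩
      have hn0 : (0 : ℝ) < n := by exact_mod_cast hn
      rw [abs_mul, mul_assoc]
      refine mul_le_mul_of_nonneg_left (hK _ n (div_pos (sub_pos.2 hαβ) hn0) ?_) (abs_nonneg _)
      rw [mul_div_cancel₀ _ hn0.ne']
      linarith [hτ.1]
    -- The coefficient `1 + (-1)^1` is zero, so the values of `ζ` and `cutoffConst` at `1` are
    -- immaterial.
    · have : m - k = 1 := by omega
      exact ⟨0, fun n _ => by simp [this]⟩
  choose! K hK using hterm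
  refine ⟨K₀ + ∑ k ∈ Finset.range m, K k, fun n hn => ?_⟩
  have hn0 : (0 : ℝ) < n := by exact_mod_cast hn
  have hT : 0 < β - α := sub_pos.2 hαβ
  -- The sum of the regularized function is completed by the node `j = 0`, whose value `taylorCoeff
  -- G τ m` is subtracted again.
  have h1 : ∑ j ∈ Finset.Ico 1 n, periodicExtension F α β (τ + j * ((β - α) / n)) =
      (∑ j ∈ Finset.range n, periodicExtension (regularized χ G τ m) α β
        (τ + j * ((β - α) / n))) - taylorCoeff G τ m +
      ∑ k ∈ Finset.range m, taylorCoeff G τ k * (1 + (-1) ^ (m - k)) *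
        ∑ j ∈ Finset.Ico 1 n,
          χ (j * ((β - α) / n)) * (j * ((β - α) / n)) ^ (-((m - k : ℕ) : ℤ)) := by
    rw [← sum_polarPart_nodes χ _ m hn, Finset.range_eq_Ico,
      Finset.sum_eq_sum_Ico_succ_bot (by omega : 0 < n), Nat.cast_zero, zero_mul, add_zero,
      periodicExtension_of_mem_Ioo _ hτ, regularized_self, add_sub_cancel_left,
      ← Finset.sum_add_distrib]
    refine Finset.sum_congr rfl fun j hj => ?_
    have hj := Finset.mem_Ico.1 hj
    have hj1 : (1 : ℝ) ≤ j := by exact_mod_cast hj.1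
    refine periodicExtension_eq_add χ hτ hα hβ hFG ⟨by positivity, ?_⟩
    have : (j : ℝ) < n := by exact_mod_cast hj.2
    rw [mul_div_assoc', div_lt_iff₀ hn0, mul_comm]
    exact mul_lt_mul_of_pos_left this hT
  have h2 : ∀ x y : ℝ, |x + y| ≤ |x| + |y| := abs_add_le
  rw [h1, add_mul, Finset.sum_mul]
  refine le_trans (le_of_eq ?_) ((h2 _ _).trans (add_le_add (hK₀ n hn)
    ((Finset.abs_sum_le_sum_abs _ _).trans (Finset.sum_le_sum fun k hk => hK k hk n hn))))
  congr 1
  have h3 : ∀ a S Z A : ℕ → ℝ, ∑ k ∈ Finset.range m, a k * ((β - α) / n * S k - (Z k - A k)) =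
      (β - α) / n * (∑ k ∈ Finset.range m, a k * S k) - (∑ k ∈ Finset.range m, a k * Z k) +
        ∑ k ∈ Finset.range m, a k * A k := by
    intro a S Z A
    rw [Finset.mul_sum, ← Finset.sum_sub_distrib, ← Finset.sum_add_distrib]
    exact Finset.sum_congr rfl fun k _ => by ring
  rw [h3 (fun k => taylorCoeff G τ k * (1 + (-1) ^ (m - k)))]
  ring

end

/-! ### The Hadamard finite part. -/

theorem ae_eq_restrict_Ioc_of_eqOn_Ioo {f g : ℝ → ℝ} {a b : ℝ} (h : EqOn f g (Ioo a b)) :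
    f =ᵐ[volume.restrict (Ioc a b)] g := by
  rw [← Measure.restrict_congr_set Ioo_ae_eq_Ioc]
  exact (ae_restrict_iff' measurableSet_Ioo).2 (ae_of_all _ fun x hx => h hx)

theorem intervalIntegrable_congr_Ioo {f g : ℝ → ℝ} {a b : ℝ} (hab : a ≤ b)
    (h : EqOn f g (Ioo a b)) (hf : IntervalIntegrable f volume a b) :
    IntervalIntegrable g volume a b := by
  rw [intervalIntegrable_iff_integrableOn_Ioc_of_le hab] at hf ⊢
  exact Integrable.congr hf (ae_eq_restrict_Ioc_of_eqOn_Ioo h)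

theorem intervalIntegral_congr_Ioo {f g : ℝ → ℝ} {a b : ℝ} (hab : a ≤ b)
    (h : EqOn f g (Ioo a b)) : ∫ x in a..b, f x = ∫ x in a..b, g x := by
  rw [intervalIntegral.integral_of_le hab, intervalIntegral.integral_of_le hab]
  exact integral_congr_ae (ae_eq_restrict_Ioc_of_eqOn_Ioo h)

section

variable (χ : ContDiffBump (0 : ℝ))

theorem continuousOn_bump_mul_zpow (s : ℕ) :
    ContinuousOn (fun y => χ y * y ^ (-(s : ℤ))) {0}ᶜ :=
  χ.continuous.continuousOn.mul (continuousOn_zpow₀ _)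

theorem continuousOn_polarPart (c : ℕ → ℝ) (m : ℕ) : ContinuousOn (polarPart χ c m) {0}ᶜ :=
  continuousOn_finsetSum _ fun _ _ => continuousOn_const.mul (continuousOn_bump_mul_zpow χ _)

theorem uIcc_subset_compl_zero {a b : ℝ} (ha : 0 < a) (hab : a ≤ b) : uIcc a b ⊆ {0}ᶜ := by
  rw [uIcc_of_le hab]
  intro x hx h
  rw [mem_singleton_iff] at h
  linarith [hx.1]

theorem integral_bump_mul_zpow_eq (s : ℕ) {ε X : ℝ} (hε : 0 < ε) (hε' : ε ≤ χ.rOut)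
    (hX : χ.rOut ≤ X) : ∫ y in ε..X, χ y * y ^ (-(s : ℤ)) =
      ∫ y in ε..χ.rOut, χ y * y ^ (-(s : ℤ)) := by
  rw [← intervalIntegral.integral_add_adjacent_intervals
    (((continuousOn_bump_mul_zpow χ s).mono
      (uIcc_subset_compl_zero hε hε')).intervalIntegrable)
    (((continuousOn_bump_mul_zpow χ s).mono
      (uIcc_subset_compl_zero χ.rOut_pos hX)).intervalIntegrable)]
  have : ∫ y in χ.rOut..X, χ y * y ^ (-(s : ℤ)) = ∫ _ in χ.rOut..X, (0 : ℝ) := by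
    refine intervalIntegral.integral_congr fun y hy => ?_
    rw [uIcc_of_le hX] at hy
    simp only [bump_eq_zero χ (hy.1.trans (le_abs_self y)), zero_mul]
  rw [this, intervalIntegral.integral_zero, add_zero]

theorem integral_polarPart (c : ℕ → ℝ) (m : ℕ) {ε X : ℝ} (hε : 0 < ε) (hε' : ε ≤ χ.rOut)
    (hX : χ.rOut ≤ X) : ∫ y in ε..X, polarPart χ c m y =
      ∑ k ∈ Finset.range m, c k * ∫ y in ε..χ.rOut, χ y * y ^ (-((m - k : ℕ) : ℤ)) := by
  simp only [polarPart]
  rw [intervalIntegral.integral_finsetSum]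
  · refine Finset.sum_congr rfl fun k _ => ?_
    rw [intervalIntegral.integral_const_mul, integral_bump_mul_zpow_eq χ _ hε hε' hX]
  · intro k _
    exact (((continuousOn_bump_mul_zpow χ _).mono
      (uIcc_subset_compl_zero hε (hε'.trans hX))).intervalIntegrable).const_mul _

/-- The symmetric integral of the polar part, in closed form. -/
theorem integral_polarPart_symm (c : ℕ → ℝ) (m : ℕ) {ε X Y : ℝ} (hε : 0 < ε) (hε' : ε ≤ χ.rIn)
    (hX : χ.rOut ≤ X) (hY : χ.rOut ≤ Y) :
    (∫ y in (-X)..(-ε), polarPart χ c m y) + ∫ y in ε..Y, polarPart χ c m y =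
      (∑ k ∈ Finset.range m, c k * (1 + (-1) ^ (m - k)) *
        -(ε ^ (-((m - k : ℕ) : ℤ) + 1) / (-((m - k : ℕ) : ℝ) + 1))) -
      ∑ k ∈ Finset.range m, c k * (1 + (-1) ^ (m - k)) * cutoffConst χ (m - k) := by
  have hε'' := hε'.trans χ.rIn_lt_rOut.le
  rw [← intervalIntegral.integral_comp_neg (fun y => polarPart χ c m y)]
  simp only [polarPart_neg]
  rw [integral_polarPart χ _ m hε hε'' hX, integral_polarPart χ _ m hε hε'' hY,
    ← Finset.sum_add_distrib, ← Finset.sum_sub_distrib]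
  refine Finset.sum_congr rfl fun k hk => ?_
  have hk := Finset.mem_range.1 hk
  by_cases h2 : 2 ≤ m - k
  · rw [integral_bump_mul_zpow χ h2 hε hε' le_rfl]
    ring
  · have : m - k = 1 := by omega
    rw [this]
    ring

theorem exists_divergent_terms (a : ℕ → ℝ) {m : ℕ} (hm : 1 ≤ m) :
    ∃ (N : ℕ) (c : ℕ → ℝ), ∀ ε : ℝ, ∑ k ∈ Finset.range m, a k * (1 + (-1) ^ (m - k)) *
        -(ε ^ (-((m - k : ℕ) : ℤ) + 1) / (-((m - k : ℕ) : ℝ) + 1)) =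
      ∑ j ∈ Finset.range N, c j * (ε ^ (j + 1))⁻¹ := by
  obtain ⟨M, rfl⟩ : ∃ M, m = M + 1 := ⟨m - 1, by omega⟩
  -- The last summand has order one and coefficient zero; the others are reindexed by `j = m - k -
  -- 2`, since order `m - k` integrates to `ε^(-(m - k - 1))`.
  refine ⟨M, fun j => a (M - 1 - j) * (1 + (-1) ^ (j + 2)) / (j + 1), fun ε => ?_⟩
  rw [Finset.sum_range_succ, show M + 1 - M = 1 by omega]
  simp only [pow_one, add_neg_cancel, mul_zero, zero_mul, add_zero]
  rw [← Finset.sum_range_reflect]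
  refine Finset.sum_congr rfl fun j hj => ?_
  have hj := Finset.mem_range.1 hj
  rw [show M + 1 - (M - 1 - j) = j + 2 by omega,
    show (-((j + 2 : ℕ) : ℤ) + 1) = -((j + 1 : ℕ) : ℤ) by push_cast; ring, zpow_neg, zpow_natCast]
  have h1 : (-((j + 2 : ℕ) : ℝ) + 1) = -(j + 1) := by push_cast; ring
  rw [h1, div_neg, neg_neg]
  ring

/-- The regularized function tends to zero at the endpoints (this uses `q ≥ 1`), so it is integrable
and its truncated integrals converge; the polar part is integrated in closed form. -/
theorem hasFinitePart_of_eq_div {F G : ℝ → ℝ} {α β τ : ℝ} {m q : ℕ} (hm : 1 ≤ m) (hq : 1 ≤ q)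
    (hτ : τ ∈ Ioo α β) (hα : α + χ.rOut < τ) (hβ : τ + χ.rOut < β)
    (hG : ContDiffOn ℝ ∞ G (Ioo α β))
    (hFG : ∀ ξ ∈ Ioo α β, ξ ≠ τ → F ξ = G ξ / (ξ - τ) ^ m)
    (hF : PeriodizedToOrder F α β q) :
    HasFinitePart F α τ β ((∫ x in α..β, regularized χ G τ m x) - ∑ k ∈ Finset.range m,
      taylorCoeff G τ k * (1 + (-1) ^ (m - k)) * cutoffConst χ (m - k)) := by
  have hαβ : α < β := hτ.1.trans hτ.2
  have hW := contDiffOn_regularized χ isOpen_Ioo hτ hG m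
  have hWp := periodizedToOrder_regularized χ hα hβ hFG hF
  have hWi : IntervalIntegrable (regularized χ G τ m) volume α β := by
    have h := hWp.1 0 hq
    rw [iteratedDeriv_zero] at h
    exact intervalIntegrable_of_tendsto_zero hαβ hW.continuousOn h.1 h.2
  set W := regularized χ G τ m with hWdef
  set P := polarPart χ (taylorCoeff G τ) m with hP
  have hrio := χ.rIn_lt_rOut
  have heqL : ∀ ε, 0 < ε → EqOn (fun ξ => W ξ + P (ξ - τ)) F (Ioo α (τ - ε)) := by
    intro ε hε ξ hξ
    have hne : ξ ≠ τ := by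
      rintro rfl
      linarith [hξ.2]
    rw [hFG ξ ⟨hξ.1, by linarith [hξ.2, hτ.2]⟩ hne]
    exact regularized_add_polarPart χ G m hne
  have heqR : ∀ ε, 0 < ε → EqOn (fun ξ => W ξ + P (ξ - τ)) F (Ioo (τ + ε) β) := by
    intro ε hε ξ hξ
    have hne : ξ ≠ τ := by
      rintro rfl
      linarith [hξ.1]
    rw [hFG ξ ⟨by linarith [hξ.1, hτ.1], hξ.2⟩ hne]
    exact regularized_add_polarPart χ G m hne
  have hPc : ContinuousOn (fun ξ => P (ξ - τ)) {τ}ᶜ :=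
    (continuousOn_polarPart χ _ m).comp (by fun_prop) fun ξ hξ => by
      simpa [sub_eq_zero] using hξ
  have hPL : ∀ ε, 0 < ε → ε ≤ χ.rIn → IntervalIntegrable (fun ξ => P (ξ - τ)) volume α (τ - ε) := by
    intro ε hε hε'
    refine (hPc.mono fun ξ hξ h => ?_).intervalIntegrable
    rw [uIcc_of_le (by linarith)] at hξ
    rw [mem_singleton_iff] at h
    linarith [hξ.2]
  have hPR : ∀ ε, 0 < ε → ε ≤ χ.rIn → IntervalIntegrable (fun ξ => P (ξ - τ)) volume (τ + ε) β := by
    intro ε hε hε'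
    refine (hPc.mono fun ξ hξ h => ?_).intervalIntegrable
    rw [uIcc_of_le (by linarith)] at hξ
    rw [mem_singleton_iff] at h
    linarith [hξ.1]
  have hWL : ∀ ε, 0 < ε → ε ≤ χ.rIn → IntervalIntegrable W volume α (τ - ε) := by
    intro ε hε hε'
    refine hWi.mono_set ?_
    rw [uIcc_of_le (by linarith), uIcc_of_le hαβ.le]
    exact Icc_subset_Icc_right (by linarith [hτ.2])
  have hWR : ∀ ε, 0 < ε → ε ≤ χ.rIn → IntervalIntegrable W volume (τ + ε) β := by
    intro ε hε hε'
    refine hWi.mono_set ?_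
    rw [uIcc_of_le (by linarith), uIcc_of_le hαβ.le]
    exact Icc_subset_Icc_left (by linarith [hτ.1])
  have hev : ∀ᶠ ε in 𝓝[>] (0 : ℝ), 0 < ε ∧ ε ≤ χ.rIn := by
    filter_upwards [Ioc_mem_nhdsGT χ.rIn_pos] with ε hε using hε
  refine ⟨?_, ?_⟩
  · filter_upwards [hev] with ε hε
    exact ⟨intervalIntegrable_congr_Ioo (by linarith) (heqL ε hε.1)
        ((hWL ε hε.1 hε.2).add (hPL ε hε.1 hε.2)),
      intervalIntegrable_congr_Ioo (by linarith) (heqR ε hε.1)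
        ((hWR ε hε.1 hε.2).add (hPR ε hε.1 hε.2))⟩
  · obtain ⟨N, c, hc⟩ := exists_divergent_terms (taylorCoeff G τ) hm
    -- There is no logarithm: the order-one pole cancels between the two sides of `τ`.
    refine ⟨N, c, 0, ?_⟩
    have hprim : ∀ p ∈ uIcc α β, ContinuousAt (fun x => ∫ ξ in p..x, W ξ) τ := by
      intro p hp
      refine (intervalIntegral.continuousOn_primitive_interval' hWi hp).continuousAt ?_
      rw [uIcc_of_le hαβ.le]
      exact Icc_mem_nhds hτ.1 hτ.2
    have hsubl : Tendsto (fun ε : ℝ => τ - ε) (𝓝[>] 0) (𝓝 τ) := by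
      have : Tendsto (fun ε : ℝ => τ - ε) (𝓝 0) (𝓝 (τ - 0)) := Continuous.tendsto (by fun_prop) 0
      rw [sub_zero] at this
      exact this.mono_left nhdsWithin_le_nhds
    have haddl : Tendsto (fun ε : ℝ => τ + ε) (𝓝[>] 0) (𝓝 τ) := by
      have : Tendsto (fun ε : ℝ => τ + ε) (𝓝 0) (𝓝 (τ + 0)) := Continuous.tendsto (by fun_prop) 0
      rw [add_zero] at this
      exact this.mono_left nhdsWithin_le_nhds
    have hlim : Tendsto (fun ε : ℝ => (∫ ξ in α..(τ - ε), W ξ) - (∫ ξ in β..(τ + ε), W ξ) -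
        ∑ k ∈ Finset.range m,
          taylorCoeff G τ k * (1 + (-1) ^ (m - k)) * cutoffConst χ (m - k)) (𝓝[>] 0)
        (𝓝 ((∫ ξ in α..τ, W ξ) - (∫ ξ in β..τ, W ξ) - ∑ k ∈ Finset.range m,
          taylorCoeff G τ k * (1 + (-1) ^ (m - k)) * cutoffConst χ (m - k))) :=
      (((hprim α left_mem_uIcc).tendsto.comp hsubl).sub
        ((hprim β right_mem_uIcc).tendsto.comp haddl)).sub_const _
    have hIL : IntervalIntegrable W volume α τ := hWi.mono_set (by
      rw [uIcc_of_le hτ.1.le, uIcc_of_le hαβ.le]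
      exact Icc_subset_Icc_right hτ.2.le)
    have hIR : IntervalIntegrable W volume τ β := hWi.mono_set (by
      rw [uIcc_of_le hτ.2.le, uIcc_of_le hαβ.le]
      exact Icc_subset_Icc_left hτ.1.le)
    rw [intervalIntegral.integral_symm τ β, sub_neg_eq_add,
      intervalIntegral.integral_add_adjacent_intervals hIL hIR] at hlim
    refine hlim.congr' ?_
    filter_upwards [hev] with ε hε
    rw [← intervalIntegral_congr_Ioo (by linarith) (heqL ε hε.1),
      ← intervalIntegral_congr_Ioo (by linarith) (heqR ε hε.1),
      intervalIntegral.integral_add (hWL ε hε.1 hε.2) (hPL ε hε.1 hε.2),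
      intervalIntegral.integral_add (hWR ε hε.1 hε.2) (hPR ε hε.1 hε.2),
      intervalIntegral.integral_comp_sub_right P, intervalIntegral.integral_comp_sub_right P,
      add_sub_cancel_left, show τ - ε - τ = -ε by ring, show α - τ = -(τ - α) by ring, ← hc,
      intervalIntegral.integral_symm (τ + ε) β]
    have h1 := integral_polarPart_symm χ (taylorCoeff G τ) m hε.1 hε.2
      (X := τ - α) (Y := β - τ) (by linarith) (by linarith)
    rw [← hP] at h1
    linear_combination -h1

end

/-! ### Parity, zeta coefficients and the final assembly. -/

/-- The parameter `p` treats both parities of the pole order at once. Raising `r` by one adds two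
indices, one with factor `2` and one with factor `0`. -/
theorem sum_one_add_neg_one_pow_mul (f : ℕ → ℝ) {p : ℕ} (hp : p ≤ 1) (r : ℕ) :
    ∑ k ∈ Finset.range (2 * r + p), (1 + (-1) ^ (2 * r + p - k)) * f k =
      2 * ∑ i ∈ Finset.range r, f (2 * i + p) := by
  induction r with
  | zero =>
    rcases p with _ | p
    · simp
    · obtain rfl : p = 0 := by omega
      simp
  | succ r ih =>
    rw [show 2 * (r + 1) + p = 2 * r + p + 1 + 1 by ring, Finset.sum_range_succ,
      Finset.sum_range_succ, Finset.sum_range_succ, mul_add, ← ih,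
      show 2 * r + p + 1 + 1 - (2 * r + p) = 2 by omega,
      show 2 * r + p + 1 + 1 - (2 * r + p + 1) = 1 by omega]
    have : ∑ k ∈ Finset.range (2 * r + p), (1 + (-1) ^ (2 * r + p + 1 + 1 - k)) * f k =
        ∑ k ∈ Finset.range (2 * r + p), (1 + (-1) ^ (2 * r + p - k)) * f k := by
      refine Finset.sum_congr rfl fun k hk => ?_
      have hk := Finset.mem_range.1 hk
      rw [show 2 * r + p + 1 + 1 - k = (2 * r + p - k) + 2 by omega, pow_add]
      norm_num
    rw [this]
    ring

/-- Only the exponents of the right parity contribute; the last term carries `ζ(0) = -1/2`. -/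
theorem sum_zeta_terms_eq (c : ℕ → ℝ) {p : ℕ} (hp : p ≤ 1) (r : ℕ) (h : ℝ) :
    (∑ k ∈ Finset.range (2 * r + p), c k * (1 + (-1) ^ (2 * r + p - k)) *
      ((riemannZeta (2 * r + p - k : ℕ)).re * h ^ (-((2 * r + p - k : ℕ) : ℤ) + 1))) -
        c (2 * r + p) * h =
      2 * ∑ i ∈ Finset.range (r + 1), c (2 * i + p) *
        (riemannZeta (2 * (r : ℂ) - 2 * (i : ℂ))).re * h ^ (-2 * (r : ℤ) + 2 * (i : ℤ) + 1) := by
  have h1 := sum_one_add_neg_one_pow_mul (fun k => c k *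
    ((riemannZeta (2 * r + p - k : ℕ)).re * h ^ (-((2 * r + p - k : ℕ) : ℤ) + 1))) hp r
  have h2 : ∑ k ∈ Finset.range (2 * r + p), c k * (1 + (-1) ^ (2 * r + p - k)) *
      ((riemannZeta (2 * r + p - k : ℕ)).re * h ^ (-((2 * r + p - k : ℕ) : ℤ) + 1)) =
      ∑ k ∈ Finset.range (2 * r + p), (1 + (-1) ^ (2 * r + p - k)) * (c k *
        ((riemannZeta (2 * r + p - k : ℕ)).re * h ^ (-((2 * r + p - k : ℕ) : ℤ) + 1))) :=
    Finset.sum_congr rfl fun k _ => by ring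
  rw [h2, h1, Finset.sum_range_succ, mul_add, sub_eq_add_neg]
  congr 1
  · congr 1
    refine Finset.sum_congr rfl fun i hi => ?_
    have hi := Finset.mem_range.1 hi
    have e : 2 * r + p - (2 * i + p) = 2 * r - 2 * i := by omega
    have e2 : ((2 * r - 2 * i : ℕ) : ℂ) = 2 * (r : ℂ) - 2 * (i : ℂ) := by
      rw [Nat.cast_sub (by omega)]
      push_cast
      ring
    have e3 : -((2 * r - 2 * i : ℕ) : ℤ) + 1 = -2 * (r : ℤ) + 2 * (i : ℤ) + 1 := by omega
    rw [e, e2, e3]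
    ring
  -- Since `2 ζ(0) = -1`, the correction for the omitted node is the summand `i = r`.
  · rw [sub_self, riemannZeta_zero, show -2 * (r : ℤ) + 2 * (r : ℤ) + 1 = 1 by ring, zpow_one]
    norm_num
    ring

theorem dslope_pos_of_deriv_pos {ψ : ℝ → ℝ} {α β τ : ℝ} (hτ : τ ∈ Ioo α β)
    (hψc : ContinuousOn ψ (Icc α β)) (hψ' : ∀ ξ ∈ Ioo α β, 0 < deriv ψ ξ) {ξ : ℝ}
    (hξ : ξ ∈ Ioo α β) : 0 < dslope ψ τ ξ := by
  rcases eq_or_ne ξ τ with rfl | hne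
  · rw [dslope_same]
    exact hψ' ξ hξ
  · rw [dslope_of_ne _ hne, slope_def_field]
    have hmono := strictMonoOn_of_deriv_pos_Ioo hψc hψ'
    rcases hne.lt_or_gt with h | h
    · exact div_pos_of_neg_of_neg (sub_neg.2 (hmono (Ioo_subset_Icc_self hξ)
        (Ioo_subset_Icc_self hτ) h)) (sub_neg.2 h)
    · exact div_pos (sub_pos.2 (hmono (Ioo_subset_Icc_self hτ)
        (Ioo_subset_Icc_self hξ) h)) (sub_pos.2 h)

theorem contDiffOn_regularPart {g ψ : ℝ → ℝ} {α β τ : ℝ} (m : ℕ) {d : Set ℝ} (hτ : τ ∈ Ioo α β)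
    (hg : ContDiffOn ℝ ∞ g d) (hψc : ContinuousOn ψ (Icc α β))
    (hψs : ContDiffOn ℝ ∞ ψ (Ioo α β)) (hψ' : ∀ ξ ∈ Ioo α β, 0 < deriv ψ ξ)
    (hmap : MapsTo ψ (Ioo α β) d) : ContDiffOn ℝ ∞ (regularPart g ψ τ m) (Ioo α β) :=
  ((hg.comp hψs hmap).mul (hψs.deriv_of_isOpen isOpen_Ioo (by simp))).div
    ((contDiffOn_dslope isOpen_Ioo hτ hψs).pow m) fun _ hξ =>
      pow_ne_zero _ (dslope_pos_of_deriv_pos hτ hψc hψ' hξ).ne'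

theorem transformed_eq_regularPart_div (g ψ : ℝ → ℝ) (τ ξ : ℝ) (m : ℕ) :
    transformed g ψ (ψ τ) m ξ = regularPart g ψ τ m ξ / (ξ - τ) ^ m := by
  have h : ψ ξ - ψ τ = (ξ - τ) * dslope ψ τ ξ := by
    rw [← smul_eq_mul, sub_smul_dslope]
  rw [transformed, singularIntegrand, regularPart, h, mul_pow, div_div, div_mul_eq_mul_div,
    mul_comm ((ξ - τ) ^ m)]

/-- The finite part and the expansion of the punctured trapezoidal sums, for both parities of the
order of the pole. -/
theorem exists_hasFinitePart_and_isBigO {F G : ℝ → ℝ} {α β τ : ℝ} {m q : ℕ} (hm : 1 ≤ m)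
    (hq : 1 ≤ q) (hτ : τ ∈ Ioo α β) (hG : ContDiffOn ℝ ∞ G (Ioo α β))
    (hFG : ∀ ξ ∈ Ioo α β, ξ ≠ τ → F ξ = G ξ / (ξ - τ) ^ m)
    (hF : PeriodizedToOrder F α β q) :
    ∃ I : ℝ, HasFinitePart F α τ β I ∧ ∀ r p : ℕ, p ≤ 1 → m = 2 * r + p →
      (fun n : ℕ => (β - α) / n * (∑ j ∈ Finset.Ico 1 n,
          periodicExtension F α β (τ + j * ((β - α) / n))) -
        (I + 2 * ∑ i ∈ Finset.range (r + 1),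
          iteratedDeriv (2 * i + p) G τ / ((2 * i + p)! : ℝ) *
            (riemannZeta (2 * (r : ℂ) - 2 * (i : ℂ))).re *
            ((β - α) / n) ^ (-2 * (r : ℤ) + 2 * (i : ℤ) + 1)))
        =O[atTop] fun n : ℕ => ((β - α) / n) ^ q := by
  have hαβ : α < β := hτ.1.trans hτ.2
  -- `δ` lies below the distance from `τ` to either endpoint, so the translated bump is supported
  -- inside `(α, β)`.
  obtain ⟨δ, hδ, hδ'⟩ := exists_between (lt_min (sub_pos.2 hτ.1) (sub_pos.2 hτ.2))
  let χ : ContDiffBump (0 : ℝ) := ⟨δ / 2, δ, by linarith, by linarith⟩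
  have hα : α + χ.rOut < τ := by
    have : δ < τ - α := hδ'.trans_le (min_le_left _ _)
    change α + δ < τ
    linarith
  have hβ : τ + χ.rOut < β := by
    have : δ < β - τ := hδ'.trans_le (min_le_right _ _)
    change τ + δ < β
    linarith
  -- The finite part is literally the constant term of `exists_bound_punctured_trapezoid` for the
  -- same `χ`, so nothing has to be evaluated.
  refine ⟨_, hasFinitePart_of_eq_div χ hm hq hτ hα hβ hG hFG hF, fun r p hp hmr => ?_⟩
  subst hmr
  obtain ⟨K, hK⟩ := exists_bound_punctured_trapezoid χ hq hτ hα hβ hG hFG hF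
  refine IsBigO.of_bound K ?_
  filter_upwards [eventually_ge_atTop 1] with n hn
  have h1 := hK n hn
  rw [sum_zeta_terms_eq _ hp] at h1
  have h2 : 0 ≤ ((β - α) / n) ^ q :=
    pow_nonneg (div_nonneg (sub_pos.2 hαβ).le (Nat.cast_nonneg n)) _
  rw [Real.norm_eq_abs, Real.norm_eq_abs, abs_of_nonneg h2]
  simp only [← iterate_dslope_same isOpen_Ioo hτ hG]
  exact h1

end PVTSI

theorem theorem5p1 (a b t α β τ : ℝ) (g ψ : ℝ → ℝ) (m q : ℕ) (hm : 1 ≤ m) (hq : 1 ≤ q)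
    (ht : t ∈ Ioo a b)
    (hg : ContDiffOn ℝ ∞ g (Ioo a b)) (hgi : IntegrableOn g (Ioo a b))
    (hψc : ContinuousOn ψ (Icc α β)) (hψs : ContDiffOn ℝ ∞ ψ (Ioo α β))
    (hψα : ψ α = a) (hψβ : ψ β = b) (hψ' : ∀ ξ ∈ Ioo α β, 0 < deriv ψ ξ)
    (hτ : τ ∈ Ioo α β) (hψτ : ψ τ = t)
    (hF : PVTSI.PeriodizedToOrder (PVTSI.transformed g ψ t m) α β q) :
    (∃ I : ℝ, PVTSI.HasFinitePart (PVTSI.transformed g ψ t m) α τ β I ∧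
      (∀ r : ℕ, m = 2 * r →
        (fun n : ℕ =>
          (β - α) / n * (∑ j ∈ Finset.Ico 1 n,
              PVTSI.periodicExtension (PVTSI.transformed g ψ t m) α β (τ + j * ((β - α) / n))) -
            (I + 2 * ∑ i ∈ Finset.range (r + 1),
              iteratedDeriv (2 * i) (PVTSI.regularPart g ψ τ m) τ / ((2 * i)! : ℝ) *
                (riemannZeta (2 * (r : ℂ) - 2 * (i : ℂ))).re *
                ((β - α) / n) ^ (-2 * (r : ℤ) + 2 * (i : ℤ) + 1)))
          =O[atTop] fun n : ℕ => ((β - α) / n) ^ q) ∧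
      (∀ r : ℕ, m = 2 * r + 1 →
        (fun n : ℕ =>
          (β - α) / n * (∑ j ∈ Finset.Ico 1 n,
              PVTSI.periodicExtension (PVTSI.transformed g ψ t m) α β (τ + j * ((β - α) / n))) -
            (I + 2 * ∑ i ∈ Finset.range (r + 1),
              iteratedDeriv (2 * i + 1) (PVTSI.regularPart g ψ τ m) τ / ((2 * i + 1)! : ℝ) *
                (riemannZeta (2 * (r : ℂ) - 2 * (i : ℂ))).re *
                ((β - α) / n) ^ (-2 * (r : ℤ) + 2 * (i : ℤ) + 1)))
          =O[atTop] fun n : ℕ => ((β - α) / n) ^ q)) ∧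
    (∀ (g₁ : ℝ → ℝ) (t₁ : ℝ) (m₁ k : ℕ), ContDiffOn ℝ ∞ g₁ (Ioo a b) →
      g₁ =ᶠ[𝓝[>] a] g → g₁ =ᶠ[𝓝[<] b] g → t₁ ∈ Ioo a b → 1 ≤ m₁ →
      ContDiffOn ℝ k ψ (Icc α β) →
      (PVTSI.PeriodizedToOrder (PVTSI.transformed g₁ ψ t₁ m₁) α β k ↔
        PVTSI.PeriodizedToOrder (PVTSI.transformed g ψ t m) α β k)) := by
  have hαβ : α < β := hτ.1.trans hτ.2
  have hmaps := PVTSI.mapsTo_Ioo_of_deriv_pos hαβ hψc hψ'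
  rw [hψα, hψβ] at hmaps
  refine ⟨?_, fun g₁ t₁ m₁ k hg₁ hga hgb ht₁ _ hψk => ⟨fun h => ?_, fun h => ?_⟩⟩
  · obtain ⟨I, hI, hexp⟩ := PVTSI.exists_hasFinitePart_and_isBigO hm hq hτ
      (PVTSI.contDiffOn_regularPart m hτ hg hψc hψs hψ' hmaps)
      (fun ξ _ _ => by rw [← hψτ, PVTSI.transformed_eq_regularPart_div]) hF
    exact ⟨I, hI, fun r hr => hexp r 0 zero_le_one hr, fun r hr => hexp r 1 le_rfl hr⟩
  -- The one-way lemma is symmetric in the two data sets; this direction is where smoothness of `g₁`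
  -- is needed.
  · exact PVTSI.periodizedToOrder_transformed_of_eventuallyEq hαβ ht₁ ht hg₁ hψc hψs hψα hψβ hψ'
      hga.symm hgb.symm hψk h
  · exact PVTSI.periodizedToOrder_transformed_of_eventuallyEq hαβ ht ht₁ hg hψc hψs hψα hψβ hψ'
      hga hgb hψk h
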